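/- Conventions. A superring is a $\mathbb Z/2$-graded, associative, unital ring $A=A_0\oplus A_1$ that is supercommutative: $ab=(-1)^{|a||b|}ba$ for homogeneous $a,b$, and $a^2=0$ for odd $a$ (automatic if $2$ is invertible). Homomorphisms preserve the grading. $\operatorname{Spec}A$ is the space of prime ideals of $A_0$ with the sheaf of superrings whose stalk at $\mathfrak p$ is the localization $A_{\mathfrak p}$. A superscheme is a topological space with a sheaf of superrings with local stalks, locally isomorphic to spectra of superrings; morphisms are the morphisms of such spaces that are local on stalks. For a point $s$ of a superscheme $\mathcal S$, $\kappa(s)$ denotes its residue field (a purely even field), and $\operatorname{Spec}\kappa(s)\to\mathcal S$ the canonical morphism. A morphism $f\colon\mathcal X\to\mathcal S$ of superschemes is: - locally of finite presentation if every point of $\mathcal X$ has an affine open neighbourhood $\operatorname{Spec}B$ that $f$ maps into an affine open $\operatorname{Spec}A\subseteq\mathcal S$, such that $B$ is isomorphic, as an $A$-superalgebra, to a quotient of a polynomial superring $A[x_1,\dots,x_m\,|\,\theta_1,\dots,\theta_n]$ (the $x_i$ even, the $\theta_j$ odd) by a finitely generated graded ideal; - a monomorphism if for every superscheme $\mathcal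 T$ the map $\operatorname{Hom}(\mathcal T,\mathcal X)\to\operatorname{Hom}(\mathcal T,\mathcal S)$ induced by $f$ is injective; - radicial if the diagonal $\Delta_f\colon\mathcal X\to\mathcal X\times_{\mathcal S}\mathcal X$ is surjective; - formally unramified if for every affine superscheme $\operatorname{Spec}B$ over $\mathcal S$ and every nilpotent graded ideal $N\subset B$ the map $\operatorname{Hom}_{\mathcal S}(\operatorname{Spec}B,\mathcal X)\to\operatorname{Hom}_{\mathcal S}(\operatorname{Spec}(B/N),\mathcal X)$ is injective. Proposition. Let $f\colon\mathcal X\to\mathcal S$ be a morphism of superschemes, locally of finite presentation. The following conditions are equivalent: 1. $f$ is a monomorphism; 2. $f$ is radicial and formally unramified; 3. for every point $s$ of $\mathcal S$, the fibre $\mathcal X_s=\operatorname{Spec}\kappa(s)\times_{\mathcal S}\mathcal X$ is either empty or isomorphic to $\operatorname{Spec}\kappa(s)$ as a superscheme over $\kappa(s)$. -/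

import Mathlib

universe u

open CategoryTheory TensorProduct

/-- A superring `A = A₀ ⊕ A₁`: a `ℤ/2`-graded, associative, unital, supercommutative ring, given by
its homogeneous components and the products of homogeneous elements. The even part `A₀` is a
commutative ring; it commutes with the odd part `A₁`, which is hence an `A₀`-module; `mul` is the
product of two odd elements. Odd elements anticommute and have square zero (the second follows from
the first if `2` is invertible). The field `mul_smul` is the associativity `(x y) z = x (y z)` for
odd `x`, `y`, `z`. See `SuperRing.Total` for the ring `A₀ ⊕ A₁`. -/
structure SuperRing : Type (u + 1) where
  even : Type u
  odd : Type u
  [commRing : CommRing even]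
  [addCommGroup : AddCommGroup odd]
  [module : Module even odd]
  mul : odd →ₗ[even] odd →ₗ[even] even
  mul_self : ∀ x, mul x x = 0
  mul_smul : ∀ x y z, mul x y • z = mul y z • x

namespace SuperRing

attribute [instance] SuperRing.commRing SuperRing.addCommGroup SuperRing.module

theorem mul_anticomm (A : SuperRing.{u}) (x y : A.odd) : A.mul x y = - A.mul y x := by
  have h := A.mul_self (x + y)
  simp only [map_add, LinearMap.add_apply, A.mul_self, zero_add, add_zero] at h
  exact eq_neg_of_add_eq_zero_right h

/-- The underlying ring `A₀ ⊕ A₁` of a superring. -/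
def Total (A : SuperRing.{u}) : Type u := A.even × A.odd

namespace Total

/-- The element `a + x`. -/
def mk {A : SuperRing.{u}} (a : A.even) (x : A.odd) : A.Total := (a, x)

@[simp] theorem mk_fst {A : SuperRing.{u}} (a : A.even) (x : A.odd) : (mk a x).1 = a := rfl
@[simp] theorem mk_snd {A : SuperRing.{u}} (a : A.even) (x : A.odd) : (mk a x).2 = x := rfl

variable (A : SuperRing.{u})

instance : AddCommGroup A.Total := inferInstanceAs (AddCommGroup (A.even × A.odd))

instance : Mul A.Total :=
  ⟨fun a b => (a.1 * b.1 + A.mul a.2 b.2, a.1 • b.2 + b.1 • a.2)⟩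

instance : One A.Total := ⟨((1 : A.even), (0 : A.odd))⟩

@[ext] theorem ext' {a b : A.Total} (h₁ : a.1 = b.1) (h₂ : a.2 = b.2) : a = b := Prod.ext h₁ h₂

@[simp] theorem add_fst (a b : A.Total) : (a + b).1 = a.1 + b.1 := rfl
@[simp] theorem add_snd (a b : A.Total) : (a + b).2 = a.2 + b.2 := rfl
@[simp] theorem zero_fst : (0 : A.Total).1 = 0 := rfl
@[simp] theorem zero_snd : (0 : A.Total).2 = 0 := rfl
@[simp] theorem one_fst : (1 : A.Total).1 = 1 := rfl
@[simp] theorem one_snd : (1 : A.Total).2 = 0 := rfl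
@[simp] theorem mul_fst (a b : A.Total) : (a * b).1 = a.1 * b.1 + A.mul a.2 b.2 := rfl
@[simp] theorem mul_snd (a b : A.Total) : (a * b).2 = a.1 • b.2 + b.1 • a.2 := rfl

instance : Ring A.Total where
  __ := (inferInstance : AddCommGroup A.Total)
  mul := (· * ·)
  one := 1
  left_distrib a b c := by ext <;> simp [mul_add, add_smul, add_add_add_comm]
  right_distrib a b c := by
    ext
    · simp [add_mul]; abel
    · simp [add_smul]; abel
  zero_mul a := by ext <;> simp
  mul_zero a := by ext <;> simp
  mul_assoc a b c := by
    ext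
    · simp [mul_add, add_mul]; ring
    · simp only [mul_snd, mul_fst, smul_add, add_smul, smul_smul, A.mul_smul a.2 b.2 c.2]
      rw [mul_comm c.1 a.1, mul_comm c.1 b.1]
      abel
  one_mul a := by ext <;> simp
  mul_one a := by ext <;> simp

end Total

/-- Morphisms of superrings: ring homomorphisms that preserve the parity. -/
structure Hom (A B : SuperRing.{u}) where
  even : A.even →+* B.even
  odd : A.odd →+ B.odd
  map_smul : ∀ (a : A.even) (x : A.odd), odd (a • x) = even a • odd x
  map_mul : ∀ x y : A.odd, even (A.mul x y) = B.mul (odd x) (odd y)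

@[ext] theorem Hom.ext' {A B : SuperRing.{u}} {f g : Hom A B}
    (h₀ : ∀ a, f.even a = g.even a) (h₁ : ∀ x, f.odd x = g.odd x) : f = g := by
  cases f; cases g
  congr
  · exact RingHom.ext h₀
  · exact AddMonoidHom.ext h₁

instance : Category SuperRing.{u} where
  Hom := Hom
  id A := ⟨RingHom.id _, AddMonoidHom.id _, fun _ _ => rfl, fun _ _ => rfl⟩
  comp f g := ⟨g.even.comp f.even, g.odd.comp f.odd,
    fun a x => by simp [f.map_smul, g.map_smul], fun x y => by simp [f.map_mul, g.map_mul]⟩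

@[simp] theorem id_even (A : SuperRing.{u}) : Hom.even (𝟙 A) = RingHom.id _ := rfl
@[simp] theorem id_odd (A : SuperRing.{u}) : Hom.odd (𝟙 A) = AddMonoidHom.id _ := rfl
@[simp] theorem comp_even {A B C : SuperRing.{u}} (f : A ⟶ B) (g : B ⟶ C) :
    Hom.even (f ≫ g) = (Hom.even g).comp (Hom.even f) := rfl
@[simp] theorem comp_odd {A B C : SuperRing.{u}} (f : A ⟶ B) (g : B ⟶ C) :
    Hom.odd (f ≫ g) = (Hom.odd g).comp (Hom.odd f) := rfl

@[ext] theorem hom_ext {A B : SuperRing.{u}} {f g : A ⟶ B}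
    (h₀ : ∀ a, Hom.even f a = Hom.even g a) (h₁ : ∀ x, Hom.odd f x = Hom.odd g x) : f = g :=
  Hom.ext' h₀ h₁

/-- The homomorphism of ungraded rings underlying a morphism of superrings. -/
def Hom.total {A B : SuperRing.{u}} (f : A ⟶ B) : A.Total →+* B.Total where
  toFun a := Total.mk (Hom.even f a.1) (Hom.odd f a.2)
  map_one' := by ext <;> simp
  map_zero' := by ext <;> simp
  map_add' a b := by ext <;> simp
  map_mul' a b := by ext <;> simp [Hom.map_smul, Hom.map_mul]

/-- The even part, as a functor. -/
def evenFunctor : SuperRing.{u} ⥤ CommRingCat.{u} where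
  obj A := CommRingCat.of A.even
  map f := CommRingCat.ofHom (Hom.even f)

/-- The odd part, as a functor to sets. -/
def oddFunctor : SuperRing.{u} ⥤ Type u where
  obj A := A.odd
  map f := ↾(Hom.odd f)

/-- A commutative ring, as a purely even superring. -/
def ofCommRing (R : Type u) [CommRing R] : SuperRing.{u} where
  even := R
  odd := PUnit
  mul := 0
  mul_self _ := rfl
  mul_smul _ _ _ := rfl

section Polynomial

/-- The extension of scalars `S ⊗_{A₀} A` along a homomorphism of commutative rings `A₀ → S`. -/
noncomputable def extendEven (A : SuperRing.{u}) (S : Type u) [CommRing S] [Algebra A.even S] :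
    SuperRing.{u} where
  even := S
  odd := S ⊗[A.even] A.odd
  mul := LinearMap.BilinForm.baseChange S A.mul
  mul_self x := by
    have anti : ∀ x y : S ⊗[A.even] A.odd, LinearMap.BilinForm.baseChange S A.mul x y +
        LinearMap.BilinForm.baseChange S A.mul y x = 0 := by
      intro x y
      induction x with
      | zero => simp
      | add x₁ x₂ h₁ h₂ =>
        simp only [map_add, LinearMap.add_apply]
        linear_combination h₁ + h₂
      | tmul s x =>
        induction y with
        | zero => simp
        | add y₁ y₂ h₁ h₂ =>
          simp only [map_add, LinearMap.add_apply]
          linear_combination h₁ + h₂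
        | tmul t y =>
          rw [LinearMap.BilinForm.baseChange_tmul, LinearMap.BilinForm.baseChange_tmul,
            A.mul_anticomm x y, mul_comm t s, neg_smul, neg_add_cancel]
    induction x with
    | zero => simp
    | add x₁ x₂ h₁ h₂ =>
      simp only [map_add, LinearMap.add_apply]
      linear_combination h₁ + h₂ + anti x₁ x₂
    | tmul s x => rw [LinearMap.BilinForm.baseChange_tmul, A.mul_self, zero_smul]
  mul_smul x y z := by
    induction x with
    | zero => simp
    | add x₁ x₂ h₁ h₂ => simp only [map_add, LinearMap.add_apply, add_smul, smul_add, h₁, h₂]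
    | tmul s x =>
      induction y with
      | zero => simp
      | add x₁ x₂ h₁ h₂ => simp only [map_add, LinearMap.add_apply, add_smul, h₁, h₂]
      | tmul t y =>
        induction z with
        | zero => simp
        | add x₁ x₂ h₁ h₂ => simp only [map_add, add_smul, smul_add, h₁, h₂]
        | tmul r z =>
          simp only [LinearMap.BilinForm.baseChange_tmul, TensorProduct.smul_tmul', smul_eq_mul,
            smul_mul_assoc]
          rw [← TensorProduct.smul_tmul', ← TensorProduct.smul_tmul', ← TensorProduct.tmul_smul,
            ← TensorProduct.tmul_smul, A.mul_smul x y z]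
          congr 1
          ring

/-- The even part of `A[θ]`: the pair `(a, α)` stands for `a + αθ`. -/
def AdjoinEven (A : SuperRing.{u}) : Type u := A.even × A.odd

/-- The odd part of `A[θ]`: the pair `(α, a)` stands for `α + aθ`. -/
def AdjoinOdd (A : SuperRing.{u}) : Type u := A.odd × A.even

namespace AdjoinEven

/-- The element `a + xθ`. -/
def mk {A : SuperRing.{u}} (a : A.even) (x : A.odd) : A.AdjoinEven := (a, x)

@[simp] theorem mk_fst {A : SuperRing.{u}} (a : A.even) (x : A.odd) : (mk a x).1 = a := rfl
@[simp] theorem mk_snd {A : SuperRing.{u}} (a : A.even) (x : A.odd) : (mk a x).2 = x := rfl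

variable (A : SuperRing.{u})

instance : AddCommGroup A.AdjoinEven := inferInstanceAs (AddCommGroup (A.even × A.odd))

instance : Mul A.AdjoinEven := ⟨fun a b => (a.1 * b.1, a.1 • b.2 + b.1 • a.2)⟩

instance : One A.AdjoinEven := ⟨((1 : A.even), (0 : A.odd))⟩

@[ext] theorem ext' {a b : A.AdjoinEven} (h₁ : a.1 = b.1) (h₂ : a.2 = b.2) : a = b :=
  Prod.ext h₁ h₂

@[simp] theorem add_fst (a b : A.AdjoinEven) : (a + b).1 = a.1 + b.1 := rfl
@[simp] theorem add_snd (a b : A.AdjoinEven) : (a + b).2 = a.2 + b.2 := rfl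
@[simp] theorem zero_fst : (0 : A.AdjoinEven).1 = 0 := rfl
@[simp] theorem zero_snd : (0 : A.AdjoinEven).2 = 0 := rfl
@[simp] theorem one_fst : (1 : A.AdjoinEven).1 = 1 := rfl
@[simp] theorem one_snd : (1 : A.AdjoinEven).2 = 0 := rfl
@[simp] theorem mul_fst (a b : A.AdjoinEven) : (a * b).1 = a.1 * b.1 := rfl
@[simp] theorem mul_snd (a b : A.AdjoinEven) : (a * b).2 = a.1 • b.2 + b.1 • a.2 := rfl

instance : CommRing A.AdjoinEven where
  __ := (inferInstance : AddCommGroup A.AdjoinEven)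
  mul := (· * ·)
  one := 1
  left_distrib a b c := by ext <;> simp [mul_add, add_smul, add_add_add_comm]
  right_distrib a b c := by ext <;> simp [add_mul, add_smul]; abel
  zero_mul a := by ext <;> simp
  mul_zero a := by ext <;> simp
  mul_assoc a b c := by
    ext
    · simp [mul_assoc]
    · simp only [mul_snd, mul_fst, smul_add, smul_smul]
      rw [mul_comm c.1 a.1, mul_comm c.1 b.1]
      abel
  one_mul a := by ext <;> simp
  mul_one a := by ext <;> simp
  mul_comm a b := by
    ext
    · simp [mul_comm]
    · simp [add_comm]

theorem smul_eq_mul' (a b : A.AdjoinEven) : a • b = a * b := rfl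

end AdjoinEven

namespace AdjoinOdd

/-- The element `a + xθ`. -/
def mk {A : SuperRing.{u}} (a : A.odd) (x : A.even) : A.AdjoinOdd := (a, x)

@[simp] theorem mk_fst {A : SuperRing.{u}} (a : A.odd) (x : A.even) : (mk a x).1 = a := rfl
@[simp] theorem mk_snd {A : SuperRing.{u}} (a : A.odd) (x : A.even) : (mk a x).2 = x := rfl

variable (A : SuperRing.{u})

instance : AddCommGroup A.AdjoinOdd := inferInstanceAs (AddCommGroup (A.odd × A.even))

instance : SMul A.AdjoinEven A.AdjoinOdd := ⟨fun a x => (a.1 • x.1, a.1 * x.2 - A.mul a.2 x.1)⟩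

@[ext] theorem ext' {a b : A.AdjoinOdd} (h₁ : a.1 = b.1) (h₂ : a.2 = b.2) : a = b :=
  Prod.ext h₁ h₂

@[simp] theorem add_fst (a b : A.AdjoinOdd) : (a + b).1 = a.1 + b.1 := rfl
@[simp] theorem add_snd (a b : A.AdjoinOdd) : (a + b).2 = a.2 + b.2 := rfl
@[simp] theorem zero_fst : (0 : A.AdjoinOdd).1 = 0 := rfl
@[simp] theorem zero_snd : (0 : A.AdjoinOdd).2 = 0 := rfl
@[simp] theorem smul_fst (a : A.AdjoinEven) (x : A.AdjoinOdd) : (a • x).1 = a.1 • x.1 := rfl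
@[simp] theorem smul_snd (a : A.AdjoinEven) (x : A.AdjoinOdd) :
    (a • x).2 = a.1 * x.2 - A.mul a.2 x.1 := rfl

instance : Module A.AdjoinEven A.AdjoinOdd where
  one_smul x := by ext <;> simp
  mul_smul a b x := by
    ext
    · simp [SemigroupAction.mul_smul]
    · simp; ring
  smul_zero a := by ext <;> simp
  smul_add a x y := by
    ext
    · simp
    · simp [mul_add]; abel
  add_smul a b x := by ext <;> simp [add_mul, add_smul]; abel
  zero_smul x := by ext <;> simp

end AdjoinOdd

/-- The superring `A[θ] = A ⊕ Aθ` with one more odd variable `θ`. Its even elements are the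
`a + αθ`, its odd elements the `α + aθ` with `a` even and `α` odd in `A`; `θ² = 0`, `αθ = -θα`. -/
def adjoinOdd (A : SuperRing.{u}) : SuperRing.{u} where
  even := A.AdjoinEven
  odd := A.AdjoinOdd
  mul := LinearMap.mk₂ A.AdjoinEven
    (fun x y => AdjoinEven.mk (A.mul x.1 y.1) (y.2 • x.1 - x.2 • y.1))
    (fun x x' y => by
      ext
      · simp
      · simp only [AdjoinEven.mk_snd, AdjoinEven.add_snd, AdjoinOdd.add_fst, AdjoinOdd.add_snd,
          add_smul, smul_add]
        abel)
    (fun a x y => by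
      ext
      · simp
      · simp only [AdjoinEven.mk_snd, AdjoinEven.mk_fst, AdjoinOdd.smul_fst, AdjoinOdd.smul_snd,
          AdjoinEven.smul_eq_mul', AdjoinEven.mul_snd, sub_smul, smul_sub, smul_smul,
          A.mul_smul a.2 x.1 y.1]
        rw [mul_comm y.2 a.1]
        abel)
    (fun x y y' => by
      ext
      · simp
      · simp only [AdjoinEven.mk_snd, AdjoinEven.add_snd, AdjoinOdd.add_fst, AdjoinOdd.add_snd,
          add_smul, smul_add]
        abel)
    (fun a x y => by
      ext
      · simp
      · simp only [AdjoinEven.mk_snd, AdjoinEven.mk_fst, AdjoinOdd.smul_fst, AdjoinOdd.smul_snd,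
          AdjoinEven.smul_eq_mul', AdjoinEven.mul_snd, sub_smul, smul_sub, smul_smul]
        rw [mul_comm x.2 a.1, A.mul_anticomm x.1 y.1, A.mul_smul a.2 y.1 x.1, neg_smul]
        abel)
  mul_self x := by
    ext
    · simp [A.mul_self]
    · simp
  mul_smul x y z := by
    ext
    · exact A.mul_smul x.1 y.1 z.1
    · simp only [LinearMap.mk₂_apply, AdjoinEven.mk_snd, AdjoinEven.mk_fst, AdjoinOdd.smul_snd,
        map_sub, map_smul, LinearMap.sub_apply, LinearMap.smul_apply, smul_eq_mul]
      rw [A.mul_anticomm y.1 x.1, A.mul_anticomm z.1 x.1]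
      ring

/-- The inclusion `A₀ → A[θ]₀`. -/
def AdjoinEven.inl (A : SuperRing.{u}) : A.even →+* A.AdjoinEven where
  toFun a := AdjoinEven.mk a 0
  map_one' := rfl
  map_zero' := rfl
  map_add' a b := by ext <;> simp
  map_mul' a b := by ext <;> simp

/-- The inclusion `A₁ → A[θ]₁`. -/
def AdjoinOdd.inl (A : SuperRing.{u}) : A.odd →+ A.AdjoinOdd where
  toFun x := AdjoinOdd.mk x 0
  map_zero' := rfl
  map_add' a b := by ext <;> simp

/-- The inclusion `A → A[θ]`. -/
def adjoinOddC (A : SuperRing.{u}) : A ⟶ A.adjoinOdd where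
  even := AdjoinEven.inl A
  odd := AdjoinOdd.inl A
  map_smul a x := by
    change AdjoinOdd.mk _ _ = AdjoinEven.mk a 0 • AdjoinOdd.mk x 0
    ext <;> simp
  map_mul x y := by
    change AdjoinEven.mk _ _ = AdjoinEven.mk (A.mul x y) ((0 : A.even) • x - (0 : A.even) • y)
    ext <;> simp

/-- `A[θ₁, …, θₙ]`. -/
def adjoinOdds (A : SuperRing.{u}) : ℕ → SuperRing.{u}
  | 0 => A
  | n + 1 => (adjoinOdds A n).adjoinOdd

/-- The inclusion `A → A[θ₁, …, θₙ]`. -/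
def adjoinOddsC (A : SuperRing.{u}) : ∀ n, A ⟶ A.adjoinOdds n
  | 0 => 𝟙 A
  | n + 1 => adjoinOddsC A n ≫ adjoinOddC _

/-- The canonical homomorphism `A → S ⊗_{A₀} A`. -/
noncomputable def extendEvenC (A : SuperRing.{u}) (S : Type u) [CommRing S] [Algebra A.even S] :
    A ⟶ A.extendEven S where
  even := algebraMap A.even S
  odd := (TensorProduct.mk A.even S A.odd 1).toAddMonoidHom
  map_smul a x := by
    change (1 : S) ⊗ₜ[A.even] (a • x) = algebraMap A.even S a • ((1 : S) ⊗ₜ[A.even] x)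
    rw [TensorProduct.tmul_smul, algebraMap_smul]
  map_mul x y := by
    change _ = LinearMap.BilinForm.baseChange S A.mul ((1 : S) ⊗ₜ x) ((1 : S) ⊗ₜ y)
    rw [LinearMap.BilinForm.baseChange_tmul, mul_one]
    exact Algebra.algebraMap_eq_smul_one (A := S) _

/-- The polynomial superring `A[x₁, …, xₘ | θ₁, …, θₙ]` in `m` even and `n` odd variables. -/
noncomputable def polynomial (A : SuperRing.{u}) (m n : ℕ) : SuperRing.{u} :=
  (A.extendEven (MvPolynomial (Fin m) A.even)).adjoinOdds n

/-- The inclusion `A → A[x₁, …, xₘ | θ₁, …, θₙ]` of the constants. -/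
noncomputable def polynomialC (A : SuperRing.{u}) (m n : ℕ) : A ⟶ A.polynomial m n :=
  A.extendEvenC (MvPolynomial (Fin m) A.even) ≫ adjoinOddsC _ n

end Polynomial

/-- A homomorphism `A → B` of superrings is of finite presentation if `B` is, as an `A`-algebra,
isomorphic to the quotient of a polynomial superring `A[x₁, …, xₘ | θ₁, …, θₙ]` by a finitely
generated ideal. -/
def Hom.FinitePresentation {A B : SuperRing.{u}} (φ : A ⟶ B) : Prop :=
  ∃ (m n : ℕ) (ψ : A.polynomial m n ⟶ B), A.polynomialC m n ≫ ψ = φ ∧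
    Function.Surjective (Hom.total ψ) ∧ (RingHom.ker (Hom.total ψ)).FG

end SuperRing

open TopologicalSpace Opposite AlgebraicGeometry

namespace SuperRing

/-! ### The affine superscheme of a superring -/

section Localization

variable (A : SuperRing.{u}) (S : Submonoid A.even)

/-- The product of odd elements in the localization of a superring at even elements:
`(x / s) (y / t) = (x y) / (s t)`. -/
noncomputable def localizedMul (x y : LocalizedModule S A.odd) : LocalizedModule S A.even :=
  LocalizedModule.liftOn₂ x y
    (fun p q => LocalizedModule.mk (A.mul p.1 q.1) (p.2 * q.2)) (by
      rintro ⟨x, s⟩ ⟨y, t⟩ ⟨x', s'⟩ ⟨y', t'⟩ ⟨u, hu⟩ ⟨v, hv⟩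
      rw [LocalizedModule.mk_eq]
      refine ⟨u * v, ?_⟩
      simp only [Submonoid.smul_def, Submonoid.coe_mul, smul_eq_mul] at *
      have h := congrArg₂ (fun a b => A.mul a b) hu hv
      simp only [map_smul, LinearMap.smul_apply, smul_eq_mul] at h
      linear_combination h)

@[simp] theorem localizedMul_mk (x y : A.odd) (s t : S) :
    A.localizedMul S (.mk x s) (.mk y t) = .mk (A.mul x y) (s * t) := by
  simp [localizedMul, LocalizedModule.liftOn₂_mk]

theorem localizedMul_add_left (x x' y : LocalizedModule S A.odd) :
    A.localizedMul S (x + x') y = A.localizedMul S x y + A.localizedMul S x' y := by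
  induction x with | h x s =>
  induction x' with | h x' s' =>
  induction y with | h y t =>
  simp only [LocalizedModule.mk_add_mk, localizedMul_mk, LocalizedModule.mk_eq]
  refine ⟨1, ?_⟩
  simp only [Submonoid.smul_def, Submonoid.coe_mul, smul_eq_mul, map_add, map_smul,
    LinearMap.add_apply, LinearMap.smul_apply, OneMemClass.coe_one]
  ring

theorem localizedMul_add_right (x y y' : LocalizedModule S A.odd) :
    A.localizedMul S x (y + y') = A.localizedMul S x y + A.localizedMul S x y' := by
  induction x with | h x s =>
  induction y' with | h y' t' =>
  induction y with | h y t =>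
  simp only [LocalizedModule.mk_add_mk, localizedMul_mk, LocalizedModule.mk_eq]
  refine ⟨1, ?_⟩
  simp only [Submonoid.smul_def, Submonoid.coe_mul, smul_eq_mul, map_add, map_smul,
    OneMemClass.coe_one]
  ring

theorem localizedMul_smul_left (a : LocalizedModule S A.even) (x y : LocalizedModule S A.odd) :
    A.localizedMul S (a • x) y = a * A.localizedMul S x y := by
  induction x with | h x s =>
  induction y with | h y t =>
  induction a with | h a r =>
  have : (LocalizedModule.mk a r • LocalizedModule.mk x s : LocalizedModule S A.odd) =
    LocalizedModule.mk (a • x) (r * s) := LocalizedModule.mk_smul_mk ..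
  rw [this]
  rw [localizedMul_mk, localizedMul_mk, map_smul, LinearMap.smul_apply, smul_eq_mul, mul_assoc]
  exact LocalizedModule.mk_mul_mk.symm

theorem localizedMul_smul_right (a : LocalizedModule S A.even) (x y : LocalizedModule S A.odd) :
    A.localizedMul S x (a • y) = a * A.localizedMul S x y := by
  induction x with | h x s =>
  induction y with | h y t =>
  induction a with | h a r =>
  have : (LocalizedModule.mk a r • LocalizedModule.mk y t : LocalizedModule S A.odd) =
    LocalizedModule.mk (a • y) (r * t) := LocalizedModule.mk_smul_mk ..
  rw [this]
  rw [localizedMul_mk, localizedMul_mk, map_smul, smul_eq_mul, mul_left_comm]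
  exact LocalizedModule.mk_mul_mk.symm

theorem localizedMul_self (x : LocalizedModule S A.odd) : A.localizedMul S x x = 0 := by
  induction x with | h x s =>
  rw [localizedMul_mk, A.mul_self, LocalizedModule.zero_mk]

theorem localizedMul_smul (x y z : LocalizedModule S A.odd) :
    A.localizedMul S x y • z = A.localizedMul S y z • x := by
  induction x with | h x s =>
  induction y with | h y t =>
  induction z with | h z r =>
  rw [localizedMul_mk, localizedMul_mk]
  refine (LocalizedModule.mk_smul_mk ..).trans (Eq.trans ?_ (LocalizedModule.mk_smul_mk ..).symm)
  rw [A.mul_smul x y z, mul_comm (t * r) s, mul_assoc]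

end Localization

section Sections

variable (A : SuperRing.{u}) (U : (Opens (PrimeSpectrum.Top A.even))ᵒᵖ)

/-- The even sections over `U`: the sections of the structure sheaf of `Spec A₀`. -/
abbrev EvenSections : Type u := (structureSheafInType A.even A.even).obj.obj U

/-- The odd sections over `U`: the sections of the quasi-coherent sheaf on `Spec A₀` associated
to the `A₀`-module `A₁`. -/
abbrev OddSections : Type u := (structureSheafInType A.even A.odd).obj.obj U

variable {A U}

variable (A) in
/-- The product of odd elements in the localization at a prime ideal of `A₀`. -/
noncomputable def primeMul (p : PrimeSpectrum A.even)
    (x y : StructureSheaf.Localizations A.odd p) : StructureSheaf.Localizations A.even p :=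
  A.localizedMul p.asIdeal.primeCompl x y

theorem primeMul_mk (p : PrimeSpectrum A.even) (x y : A.odd) (s t : p.asIdeal.primeCompl) :
    A.primeMul p (.mk x s) (.mk y t) = .mk (A.mul x y) (s * t) :=
  A.localizedMul_mk p.asIdeal.primeCompl x y s t

theorem primeMul_add_left (p : PrimeSpectrum A.even) (x x' y : StructureSheaf.Localizations A.odd p) :
    A.primeMul p (x + x') y = A.primeMul p x y + A.primeMul p x' y :=
  A.localizedMul_add_left p.asIdeal.primeCompl x x' y

theorem primeMul_add_right (p : PrimeSpectrum A.even)
    (x y y' : StructureSheaf.Localizations A.odd p) :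
    A.primeMul p x (y + y') = A.primeMul p x y + A.primeMul p x y' :=
  A.localizedMul_add_right p.asIdeal.primeCompl x y y'

theorem primeMul_smul_left (p : PrimeSpectrum A.even) (a : StructureSheaf.Localizations A.even p)
    (x y : StructureSheaf.Localizations A.odd p) :
    A.primeMul p (a • x) y = a * A.primeMul p x y :=
  A.localizedMul_smul_left p.asIdeal.primeCompl a x y

theorem primeMul_smul_right (p : PrimeSpectrum A.even) (a : StructureSheaf.Localizations A.even p)
    (x y : StructureSheaf.Localizations A.odd p) :
    A.primeMul p x (a • y) = a * A.primeMul p x y :=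
  A.localizedMul_smul_right p.asIdeal.primeCompl a x y

theorem primeMul_self (p : PrimeSpectrum A.even) (x : StructureSheaf.Localizations A.odd p) :
    A.primeMul p x x = 0 :=
  A.localizedMul_self p.asIdeal.primeCompl x

theorem primeMul_smul (p : PrimeSpectrum A.even) (x y z : StructureSheaf.Localizations A.odd p) :
    A.primeMul p x y • z = A.primeMul p y z • x :=
  A.localizedMul_smul p.asIdeal.primeCompl x y z

/-- The product of two odd sections. -/
noncomputable def sectionMul (s t : A.OddSections U) : A.EvenSections U :=
  ⟨fun p => A.primeMul p.1 (s.1 p) (t.1 p), fun p => by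
    obtain ⟨V, hV, iV, x, a, h⟩ := s.2 p
    obtain ⟨W, hW, iW, y, b, k⟩ := t.2 p
    refine ⟨V ⊓ W, ⟨hV, hW⟩, Opens.infLELeft _ _ ≫ iV, A.mul x y, a * b, fun q => ?_⟩
    obtain ⟨ha, hx⟩ := h ⟨q.1, q.2.1⟩
    obtain ⟨hb, hy⟩ := k ⟨q.1, q.2.2⟩
    exact ⟨(PrimeSpectrum.isPrime q.1).mul_notMem ha hb,
      (congrArg₂ (A.primeMul q.1) hx hy).trans (primeMul_mk ..)⟩⟩

variable (A U)

/-- The superring of sections over `U` of the structure sheaf of the spectrum of `A`. -/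
noncomputable def sections : SuperRing.{u} where
  even := A.EvenSections U
  odd := A.OddSections U
  mul := LinearMap.mk₂ _ sectionMul
    (fun s s' t => Subtype.ext <| funext fun p =>
      primeMul_add_left p.1 (s.1 p) (s'.1 p) (t.1 p))
    (fun a s t => Subtype.ext <| funext fun p =>
      primeMul_smul_left p.1 (a.1 p) (s.1 p) (t.1 p))
    (fun s t t' => Subtype.ext <| funext fun p =>
      primeMul_add_right p.1 (s.1 p) (t.1 p) (t'.1 p))
    (fun a s t => Subtype.ext <| funext fun p =>
      primeMul_smul_right p.1 (a.1 p) (s.1 p) (t.1 p))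
  mul_self s := Subtype.ext <| funext fun p =>
    primeMul_self p.1 (s.1 p)
  mul_smul s t r := Subtype.ext <| funext fun p =>
    primeMul_smul p.1 (s.1 p) (t.1 p) (r.1 p)

/-- The structure presheaf of the spectrum of `A`. -/
noncomputable def structurePresheaf : TopCat.Presheaf SuperRing.{u} (PrimeSpectrum.Top A.even) where
  obj U := sections A U
  map i :=
    { even := ((structurePresheafInCommRingCat A.even).map i).hom
      odd :=
        { toFun := (structureSheafInType A.even A.odd).obj.map i
          map_zero' := rfl
          map_add' _ _ := rfl }
      map_smul _ _ := rfl
      map_mul _ _ := rfl }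

/-- The spectrum of `A`: the space of prime ideals of `A₀` with the sheaf of superrings whose stalk
at `p` is the localization of `A` at `p`. -/
noncomputable def specPresheafedSpace : PresheafedSpace SuperRing.{u} where
  carrier := PrimeSpectrum.Top A.even
  presheaf := A.structurePresheaf

end Sections
end SuperRing

/-- A superscheme: a topological space with a sheaf of superrings whose stalks are local, which is
locally isomorphic to the spectrum of a superring. (A superring is local if and only if its even
part is.) -/
structure Superscheme : Type (u + 1) where
  toPresheafedSpace : PresheafedSpace.{u, u + 1, u} SuperRing.{u}
  isSheaf_even : TopCat.Presheaf.IsSheaf.{u} (toPresheafedSpace.presheaf ⋙ SuperRing.evenFunctor)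
  isSheaf_odd : TopCat.Presheaf.IsSheaf.{u} (toPresheafedSpace.presheaf ⋙ SuperRing.oddFunctor)
  isLocalRing : ∀ x : toPresheafedSpace,
    IsLocalRing
    (TopCat.Presheaf.stalk (C := CommRingCat.{u}) (toPresheafedSpace.presheaf ⋙ SuperRing.evenFunctor) x)
  local_affine : ∀ x : toPresheafedSpace, ∃ (U : OpenNhds x) (A : SuperRing.{u}),
    Nonempty (toPresheafedSpace.restrict U.isOpenEmbedding ≅ A.specPresheafedSpace)

namespace Superscheme

instance : CoeSort Superscheme.{u} (Type u) := ⟨fun X => X.toPresheafedSpace⟩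

/-- The locally ringed space `(X, 𝒪₊)` defined by the even part of the structure sheaf. -/
def evenLocallyRingedSpace (X : Superscheme.{u}) : LocallyRingedSpace.{u} where
  carrier := X.toPresheafedSpace.carrier
  presheaf := X.toPresheafedSpace.presheaf ⋙ SuperRing.evenFunctor
  IsSheaf := X.isSheaf_even
  isLocalRing := X.isLocalRing

/-- The scheme `(X, 𝒪₊)` defined by the even part of the structure sheaf. -/
noncomputable def evenScheme (X : Superscheme.{u}) : Scheme.{u} where
  toLocallyRingedSpace := X.evenLocallyRingedSpace
  local_affine x := by
    obtain ⟨U, A, ⟨e⟩⟩ := X.local_affine x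
    refine ⟨U, CommRingCat.of A.even, ⟨LocallyRingedSpace.isoOfSheafedSpaceIso ?_⟩⟩
    let e' := SuperRing.evenFunctor.mapPresheaf.mapIso e
    exact ⟨⟨e'.hom⟩, ⟨e'.inv⟩, InducedCategory.Hom.ext e'.hom_inv_id,
      InducedCategory.Hom.ext e'.inv_hom_id⟩

/-- A morphism of superschemes is a morphism of spaces with a sheaf of superrings that is local
on the stalks. -/
structure Hom (X Y : Superscheme.{u}) where
  toHom : X.toPresheafedSpace ⟶ Y.toPresheafedSpace
  prop : ∀ x : X.toPresheafedSpace, IsLocalHom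
    (PresheafedSpace.Hom.stalkMap (SuperRing.evenFunctor.mapPresheaf.map toHom) x).hom

theorem Hom.ext' {X Y : Superscheme.{u}} {f g : Hom X Y} (h : f.toHom = g.toHom) : f = g := by
  cases f; cases g; congr

/-- The morphism of the even locally ringed spaces induced by a morphism of superschemes. -/
def Hom.evenHom {X Y : Superscheme.{u}} (f : Hom X Y) :
    X.evenLocallyRingedSpace ⟶ Y.evenLocallyRingedSpace :=
  ⟨SuperRing.evenFunctor.mapPresheaf.map f.toHom, f.prop⟩

instance : Category Superscheme.{u} where
  Hom := Hom
  id X := ⟨𝟙 _, fun x => by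
    rw [CategoryTheory.Functor.map_id]
    exact (𝟙 X.evenLocallyRingedSpace : X.evenLocallyRingedSpace ⟶ _).prop x⟩
  comp f g := ⟨f.toHom ≫ g.toHom, fun x => by
    rw [CategoryTheory.Functor.map_comp]
    exact (Hom.evenHom f ≫ Hom.evenHom g).prop x⟩
  id_comp f := Hom.ext' (Category.id_comp _)
  comp_id f := Hom.ext' (Category.comp_id _)
  assoc f g h := Hom.ext' (Category.assoc _ _ _)

/-- The affine superscheme `Spec A`. -/
noncomputable def Spec (A : SuperRing.{u}) : Superscheme.{u} where
  toPresheafedSpace := A.specPresheafedSpace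
  isSheaf_even := (Spec.structureSheaf A.even).2
  isSheaf_odd := (structureSheafInType A.even A.odd).2
  isLocalRing := (Spec.locallyRingedSpaceObj (CommRingCat.of A.even)).isLocalRing
  local_affine _ := ⟨⊤, A, ⟨PresheafedSpace.restrictTopIso _⟩⟩


end Superscheme

namespace SuperRing

theorem map_mul_eq_zero {A : SuperRing.{u}} {R : Type u} [CommRing R] (h : IsReduced R)
    (f : A.even →+* R) (x y : A.odd) : f (A.mul x y) = 0 := by
  have hsq : A.mul x y * A.mul x y = 0 := by
    have h1 := congrArg (A.mul x) (A.mul_smul x y y)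
    rw [A.mul_self y, zero_smul, map_zero, map_smul, smul_eq_mul] at h1
    exact h1
  exact h.eq_zero _ ⟨2, by rw [pow_two, ← _root_.map_mul, hsq, _root_.map_zero]⟩

/-- A homomorphism of the even parts, with values in a reduced ring, extends by zero on the odd
part. -/
def Hom.ofReduced {A B : SuperRing.{u}} (h : IsReduced B.even) (f : A.even →+* B.even) : A ⟶ B where
  even := f
  odd := 0
  map_smul _ _ := (smul_zero _).symm
  map_mul x y := by
    rw [map_mul_eq_zero h f x y]
    exact (_root_.map_zero (B.mul 0)).symm

/-- The odd component of a homomorphism of superrings as a semilinear map. -/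
def Hom.oddₛₗ {A B : SuperRing.{u}} (φ : A ⟶ B) : A.odd →ₛₗ[Hom.even φ] B.odd where
  toFun := Hom.odd φ
  map_add' := map_add _
  map_smul' := Hom.map_smul φ

theorem comapFun_primeMul {A B : SuperRing.{u}} (φ : A ⟶ B) (p : PrimeSpectrum B.even)
    (x y : StructureSheaf.Localizations A.odd (p.comap (Hom.even φ))) :
    StructureSheaf.Localizations.comapFun (Hom.even φ).toSemilinearMap p
      (A.primeMul (p.comap (Hom.even φ)) x y) =
    B.primeMul p (StructureSheaf.Localizations.comapFun (Hom.oddₛₗ φ) p x)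
      (StructureSheaf.Localizations.comapFun (Hom.oddₛₗ φ) p y) := by
  induction x using LocalizedModule.induction_on with | h x s =>
  induction y using LocalizedModule.induction_on with | h y t =>
  refine ((congrArg _ (A.primeMul_mk (p.comap (Hom.even φ)) x y s t)).trans
    (StructureSheaf.Localizations.comapFun_mk ..)).trans (Eq.symm ?_)
  refine ((congrArg₂ (B.primeMul p) (StructureSheaf.Localizations.comapFun_mk ..)
    (StructureSheaf.Localizations.comapFun_mk ..)).trans (B.primeMul_mk ..)).trans ?_
  have h : Hom.even φ (A.mul x y) = B.mul (Hom.odd φ x) (Hom.odd φ y) := Hom.map_mul φ x y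
  refine congrArg₂ LocalizedModule.mk h.symm (Subtype.ext ?_)
  exact (_root_.map_mul (Hom.even φ) s.1 t.1).symm

theorem comapFun_smul {A B : SuperRing.{u}} (φ : A ⟶ B) (p : PrimeSpectrum B.even)
    (a : StructureSheaf.Localizations A.even (p.comap (Hom.even φ)))
    (x : StructureSheaf.Localizations A.odd (p.comap (Hom.even φ))) :
    StructureSheaf.Localizations.comapFun (Hom.oddₛₗ φ) p (a • x) =
    StructureSheaf.Localizations.comapFun (Hom.even φ).toSemilinearMap p a •
      StructureSheaf.Localizations.comapFun (Hom.oddₛₗ φ) p x := by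
  induction a using LocalizedModule.induction_on with | h a s =>
  induction x using LocalizedModule.induction_on with | h x t =>
  refine ((congrArg _ (LocalizedModule.mk_smul_mk ..)).trans
    (StructureSheaf.Localizations.comapFun_mk ..)).trans (Eq.symm ?_)
  refine ((congrArg₂ (· • ·) (StructureSheaf.Localizations.comapFun_mk ..)
    (StructureSheaf.Localizations.comapFun_mk ..)).trans (LocalizedModule.mk_smul_mk ..)).trans ?_
  refine congrArg₂ LocalizedModule.mk (Hom.map_smul φ a x).symm (Subtype.ext ?_)
  exact (_root_.map_mul (Hom.even φ) s.1 t.1).symm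

/-- The map on sections induced by a homomorphism `φ : A → B`, from the sections of the spectrum of
`A` over `U` to the sections of the spectrum of `B` over the preimage of `U`. -/
noncomputable def Hom.sectionsMap {A B : SuperRing.{u}} (φ : A ⟶ B)
    (U : Opens (PrimeSpectrum.Top A.even)) (V : Opens (PrimeSpectrum.Top B.even))
    (hUV : V.1 ⊆ PrimeSpectrum.comap (Hom.even φ) ⁻¹' U.1) :
    A.sections (op U) ⟶ B.sections (op V) where
  even := StructureSheaf.comap (Hom.even φ) U V hUV
  odd := (StructureSheaf.comapₗ (Hom.oddₛₗ φ) U V hUV).toAddMonoidHom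
  map_smul _ _ := Subtype.ext <| funext fun p => comapFun_smul φ p.1 _ _
  map_mul _ _ := Subtype.ext <| funext fun p => comapFun_primeMul φ p.1 _ _

/-- The morphism of spectra induced by a homomorphism `A → B`. -/
noncomputable def Hom.specMap {A B : SuperRing.{u}} (φ : A ⟶ B) :
    B.specPresheafedSpace ⟶ A.specPresheafedSpace where
  base := Spec.topMap (evenFunctor.map φ)
  c :=
    { app U := Hom.sectionsMap φ U.unop
        ((Opens.map (Spec.topMap (evenFunctor.map φ))).obj U.unop) fun _ => id
      naturality _ _ _ := rfl }

end SuperRing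

namespace Superscheme

/-- The morphism `Spec B → Spec A` of affine superschemes induced by a homomorphism `A → B`. -/
noncomputable def Spec.map {A B : SuperRing.{u}} (φ : A ⟶ B) : Spec B ⟶ Spec A where
  toHom := SuperRing.Hom.specMap φ
  prop := (Spec.locallyRingedSpaceMap (SuperRing.evenFunctor.map φ)).prop

/-- The residue field `κ(x)`: the residue field of the even part of the local superring at `x`. As odd
elements are nilpotent, it is also that of the bosonic reduction. -/
noncomputable def residueField (X : Superscheme.{u}) (x : X) : Type u :=
  @IsLocalRing.ResidueField (X.evenLocallyRingedSpace.presheaf.stalk x) _ (X.isLocalRing x)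

noncomputable instance (X : Superscheme.{u}) (x : X) : Field (X.residueField x) :=
  @IsLocalRing.ResidueField.field (X.evenLocallyRingedSpace.presheaf.stalk x) _ (X.isLocalRing x)

/-- A morphism of the even parts from a superscheme `Z` with reduced even part extends to a morphism
of superschemes, by zero on the odd sections: products of two odd sections have square zero. -/
def homOfReduced {Z X : Superscheme.{u}}
    (hZ : ∀ U, IsReduced (Z.toPresheafedSpace.presheaf.obj U).even)
    (g : Z.evenLocallyRingedSpace ⟶ X.evenLocallyRingedSpace) : Z ⟶ X where
  toHom :=
    { base := g.base
      c :=
        { app U := SuperRing.Hom.ofReduced (hZ _) (g.c.app U).hom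
          naturality U V i := by
            apply SuperRing.hom_ext
            · intro a
              exact ConcreteCategory.congr_hom (g.c.naturality i) a
            · intro x
              exact ((SuperRing.Hom.odd (Z.toPresheafedSpace.presheaf.map
                ((Opens.map g.base).op.map i))).map_zero).symm } }
  prop := g.prop

instance isReduced_sections (K : Type u) [Field K] (U) :
    IsReduced ((Spec (SuperRing.ofCommRing K)).toPresheafedSpace.presheaf.obj U).even :=
  (inferInstance : AlgebraicGeometry.IsReduced
    (AlgebraicGeometry.Spec (CommRingCat.of K))).component_reduced U.unop

/-- The canonical morphism `Spec κ(x) → X`, where `κ(x)` is purely even. -/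
noncomputable def fromSpecResidueField (X : Superscheme.{u}) (x : X) :
    Spec (SuperRing.ofCommRing (X.residueField x)) ⟶ X :=
  homOfReduced (isReduced_sections (X.residueField x))
    (X.evenScheme.fromSpecResidueField x).toLRSHom

end Superscheme

namespace Superscheme

open Limits

/-- A morphism is locally of finite presentation if every point of the source has an affine open
neighbourhood `Spec B` mapped into an affine open `Spec A` of the target by a homomorphism `A → B`
of finite presentation. -/
def LocallyOfFinitePresentation {X S : Superscheme.{u}} (f : X ⟶ S) : Prop :=
  ∀ x : X, ∃ (A B : SuperRing.{u}) (φ : A ⟶ B) (j : Spec B ⟶ X) (i : Spec A ⟶ S),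
    PresheafedSpace.IsOpenImmersion (Hom.toHom j) ∧ PresheafedSpace.IsOpenImmersion (Hom.toHom i) ∧
    x ∈ Set.range (Hom.toHom j).base ∧ SuperRing.Hom.FinitePresentation φ ∧
    j ≫ f = Spec.map φ ≫ i

/-- A morphism is radicial if the diagonal `X → X ×_S X` is surjective. -/
def Radicial {X S : Superscheme.{u}} (f : X ⟶ S) : Prop :=
  ∃ _ : HasPullback f f, Function.Surjective (Hom.toHom (pullback.diagonal f)).base

/-- A morphism `f : X → S` is formally unramified if for every affine superscheme `Spec B` over `S`
and every nilpotent ideal `N` of `B` (the kernel of a surjective homomorphism `π : B → C`, so that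
`C = B / N`) the map `Hom_S(Spec B, X) → Hom_S(Spec C, X)` is injective. -/
def FormallyUnramified {X S : Superscheme.{u}} (f : X ⟶ S) : Prop :=
  ∀ (B C : SuperRing.{u}) (π : B ⟶ C), Function.Surjective (SuperRing.Hom.total π) →
    IsNilpotent (RingHom.ker (SuperRing.Hom.total π)) →
    ∀ (s : Spec B ⟶ S) (g h : Spec B ⟶ X), g ≫ f = s → h ≫ f = s →
      Spec.map π ≫ g = Spec.map π ≫ h → g = h

/-- The fibre `X_s = Spec κ(s) ×_S X` over the point `s` is empty, or isomorphic to `Spec κ(s)` as a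
superscheme over `κ(s)`. -/
def FiberEmptyOrPoint {X S : Superscheme.{u}} (f : X ⟶ S) (s : S) : Prop :=
  ∃ _ : HasPullback (S.fromSpecResidueField s) f,
    IsEmpty (pullback (S.fromSpecResidueField s) f : Superscheme.{u}) ∨
    Nonempty (Over.mk (pullback.fst (S.fromSpecResidueField s) f) ≅
      Over.mk (𝟙 (Spec (SuperRing.ofCommRing (S.residueField s)))))

end Superscheme

/-! A monomorphism is detected by very small test objects: the spectra of trivial extensions `K ⊕ V
⊕ W` of a field, lying over `S` through `Spec K`. This is the criterion
`mono_of_injectiveOnTrivialExtensions`, and conditions 2 and 3 each imply its hypothesis directly.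

Its algebraic core is `hom_eq_of_isLocalRing`. Let `γ, η : B ⟶ D` agree on `A`, with `D` local and
`B` finitely generated over `A`. Testing with `V = W = 0` shows that they agree modulo the maximal
ideal `𝔪`. The graded ideal `I` generated by the differences `γ - η` on the generators contains all
differences, and modulo `𝔪 I` and `D₁ I` the difference becomes a derivation into vector spaces over
the residue field. Such a derivation is a homomorphism to a trivial extension, to be compared with
the one given by the zero derivation, so it vanishes. Nakayama's lemma (`GradedIdeal.span_eq_bot`)
then gives `I = 0`. The passage from superschemes to this statement is `hom_ext_stalk`: morphisms
are compared on points and on homomorphisms from stalks to local superrings.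

Conversely, let `f` be a monomorphism. The diagonal is then an isomorphism, and formal
unramifiedness is cancellation. For the fibres, `κ(f x) → κ(x)` is an epimorphism of rings out of a
field, hence bijective; so `Spec κ(s)` lifts to `X` when `s` is in the image, and pulling back a
monomorphism along a morphism that lifts through it gives an isomorphism. -/

namespace SuperRing

/-! ### Graded ideals and generators -/

/-- A graded ideal of a superring, given by its homogeneous components. -/
structure GradedIdeal (D : SuperRing.{u}) where
  even : Submodule D.even D.even
  odd : Submodule D.even D.odd
  mul_mem : ∀ x, ∀ y ∈ odd, D.mul x y ∈ even
  smul_mem : ∀ a ∈ even, ∀ x : D.odd, a • x ∈ odd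

/-- Two homomorphisms of superrings are congruent modulo a graded ideal of the target. -/
def GradedIdeal.Congr {B D : SuperRing.{u}} (I : D.GradedIdeal) (γ η : B ⟶ D) : Prop :=
  (∀ b, Hom.even γ b - Hom.even η b ∈ I.even) ∧ ∀ β, Hom.odd γ β - Hom.odd η β ∈ I.odd

section Congr

variable {B D : SuperRing.{u}} (I : D.GradedIdeal) (γ η : B ⟶ D)

/-- Leibniz rule twisted by `γ` on one factor and `η` on the other; it becomes the ordinary one in a
quotient on which `γ` and `η` act in the same way. -/
theorem Hom.even_mul_sub (a b : B.even) :
    Hom.even γ (a * b) - Hom.even η (a * b) = Hom.even γ a • (Hom.even γ b - Hom.even η b) +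
      Hom.even η b • (Hom.even γ a - Hom.even η a) := by
  simp only [_root_.map_mul, smul_eq_mul]; ring

theorem Hom.odd_smul_sub (a : B.even) (x : B.odd) :
    Hom.odd γ (a • x) - Hom.odd η (a • x) = Hom.even γ a • (Hom.odd γ x - Hom.odd η x) +
      (Hom.even γ a - Hom.even η a) • Hom.odd η x := by
  rw [Hom.map_smul, Hom.map_smul, smul_sub, sub_smul]; abel

/-- The minus sign comes from anticommuting, which puts both differences into the second slot, where
`GradedIdeal.mul_mem` applies. -/
theorem Hom.even_oddMul_sub (x y : B.odd) :
    Hom.even γ (B.mul x y) - Hom.even η (B.mul x y) =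
      D.mul (Hom.odd γ x) (Hom.odd γ y - Hom.odd η y) -
        D.mul (Hom.odd η y) (Hom.odd γ x - Hom.odd η x) := by
  rw [Hom.map_mul, Hom.map_mul, map_sub, map_sub, D.mul_anticomm (Hom.odd η y) (Hom.odd γ x),
    D.mul_anticomm (Hom.odd η y) (Hom.odd η x)]
  ring

theorem GradedIdeal.sub_add_mem {b b' : B.even} (h : Hom.even γ b - Hom.even η b ∈ I.even)
    (h' : Hom.even γ b' - Hom.even η b' ∈ I.even) :
    Hom.even γ (b + b') - Hom.even η (b + b') ∈ I.even := by
  rw [map_add, map_add, add_sub_add_comm]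
  exact add_mem h h'

theorem GradedIdeal.sub_oddAdd_mem {α β : B.odd} (h : Hom.odd γ α - Hom.odd η α ∈ I.odd)
    (h' : Hom.odd γ β - Hom.odd η β ∈ I.odd) :
    Hom.odd γ (α + β) - Hom.odd η (α + β) ∈ I.odd := by
  rw [map_add, map_add, add_sub_add_comm]
  exact add_mem h h'

theorem GradedIdeal.sub_mul_mem {b b' : B.even} (h : Hom.even γ b - Hom.even η b ∈ I.even)
    (h' : Hom.even γ b' - Hom.even η b' ∈ I.even) :
    Hom.even γ (b * b') - Hom.even η (b * b') ∈ I.even := by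
  rw [Hom.even_mul_sub]
  exact add_mem (I.even.smul_mem _ h') (I.even.smul_mem _ h)

theorem GradedIdeal.sub_smul_mem {b : B.even} {β : B.odd}
    (h : Hom.even γ b - Hom.even η b ∈ I.even) (h' : Hom.odd γ β - Hom.odd η β ∈ I.odd) :
    Hom.odd γ (b • β) - Hom.odd η (b • β) ∈ I.odd := by
  rw [Hom.odd_smul_sub]
  exact add_mem (I.odd.smul_mem _ h') (I.smul_mem _ h _)

theorem GradedIdeal.sub_oddMul_mem {α β : B.odd} (h : Hom.odd γ α - Hom.odd η α ∈ I.odd)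
    (h' : Hom.odd γ β - Hom.odd η β ∈ I.odd) :
    Hom.even γ (B.mul α β) - Hom.even η (B.mul α β) ∈ I.even := by
  rw [Hom.even_oddMul_sub]
  exact sub_mem (I.mul_mem _ _ h') (I.mul_mem _ _ h)

end Congr

/-- The superring `B` is generated by the image of `A` and the homogeneous elements in `s` and `t`:
homomorphisms out of `B` are congruent modulo a graded ideal if they are so on `A`, `s` and `t`. -/
def Hom.GeneratedBy {A B : SuperRing.{u}} (φ : A ⟶ B) (s : Set B.even) (t : Set B.odd) : Prop :=
  ∀ ⦃D : SuperRing.{u}⦄ (γ η : B ⟶ D) (I : D.GradedIdeal), I.Congr (φ ≫ γ) (φ ≫ η) →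
    (∀ b ∈ s, Hom.even γ b - Hom.even η b ∈ I.even) →
    (∀ β ∈ t, Hom.odd γ β - Hom.odd η β ∈ I.odd) → I.Congr γ η

/-- A homomorphism of superrings is of finite type if the target is generated over the source by
finitely many homogeneous elements. -/
def Hom.FiniteType {A B : SuperRing.{u}} (φ : A ⟶ B) : Prop :=
  ∃ (s : Set B.even) (t : Set B.odd), s.Finite ∧ t.Finite ∧ Hom.GeneratedBy φ s t

/-- Generation is phrased through congruences of homomorphisms, so transitivity is formal:
congruence on `A` propagates to `B`, then to `C`. -/
theorem Hom.FiniteType.comp {A B C : SuperRing.{u}} {φ : A ⟶ B} {ψ : B ⟶ C}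
    (hφ : Hom.FiniteType φ) (hψ : Hom.FiniteType ψ) : Hom.FiniteType (φ ≫ ψ) := by
  obtain ⟨s, t, hs, ht, h⟩ := hφ
  obtain ⟨s', t', hs', ht', h'⟩ := hψ
  refine ⟨Hom.even ψ '' s ∪ s', Hom.odd ψ '' t ∪ t', (hs.image _).union hs', (ht.image _).union ht',
    fun D γ η I hI hs ht => h' γ η I (h (ψ ≫ γ) (ψ ≫ η) I (by simpa only [Category.assoc] using hI)
      (fun b hb => hs _ (.inl ⟨b, hb, rfl⟩)) (fun b hb => ht _ (.inl ⟨b, hb, rfl⟩)))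
      (fun b hb => hs _ (.inr hb)) (fun b hb => ht _ (.inr hb))⟩

theorem Hom.FiniteType.id (A : SuperRing.{u}) : Hom.FiniteType (𝟙 A) :=
  ⟨∅, ∅, Set.finite_empty, Set.finite_empty, fun D γ η I hI _ _ => by
    simpa only [Category.id_comp] using hI⟩

theorem Hom.FiniteType.of_surjective {A B : SuperRing.{u}} {φ : A ⟶ B}
    (h : Function.Surjective (Hom.total φ)) : Hom.FiniteType φ := by
  refine ⟨∅, ∅, Set.finite_empty, Set.finite_empty, fun D γ η I hI _ _ => ⟨fun b => ?_, fun b => ?_⟩⟩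
  · obtain ⟨a, ha⟩ := h (Total.mk b 0)
    have : Hom.even φ a.1 = b := congrArg Prod.fst ha
    subst this
    exact hI.1 a.1
  · obtain ⟨a, ha⟩ := h (Total.mk 0 b)
    have : Hom.odd φ a.2 = b := congrArg Prod.snd ha
    subst this
    exact hI.2 a.2

theorem finiteType_adjoinOddC (A : SuperRing.{u}) : Hom.FiniteType A.adjoinOddC := by
  refine ⟨∅, {AdjoinOdd.mk 0 1}, Set.finite_empty, Set.finite_singleton _,
    fun D γ η I hI _ ht => ?_⟩
  have hθ := ht _ rfl
  refine ⟨fun b => ?_, fun β => ?_⟩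
  -- The second summand is the product `α · θ` of odd elements of `A[θ]`, left in the unfolded form
  -- of its definition so that `sub_oddMul_mem` applies.
  · have hb : b = AdjoinEven.mk b.1 0 + AdjoinEven.mk (A.mul b.2 0) ((1 : A.even) • b.2 -
        (0 : A.even) • (0 : A.odd)) :=
      AdjoinEven.ext' _ (by simp) (by simp)
    rw [hb]
    exact I.sub_add_mem γ η (hI.1 b.1) (I.sub_oddMul_mem γ η (hI.2 b.2) hθ)
  · have hb : β = AdjoinOdd.mk β.1 0 + AdjoinEven.mk β.2 0 • AdjoinOdd.mk (0 : A.odd) 1 :=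
      AdjoinOdd.ext' _ (by simp) (by simp)
    rw [hb]
    exact I.sub_oddAdd_mem γ η (hI.2 β.1) (I.sub_smul_mem γ η (hI.1 β.2) hθ)

theorem finiteType_adjoinOddsC (A : SuperRing.{u}) : ∀ n, Hom.FiniteType (A.adjoinOddsC n)
  | 0 => .id A
  | n + 1 => (finiteType_adjoinOddsC A n).comp (finiteType_adjoinOddC _)

/-- The variables suffice as generators: the odd part is spanned over the polynomial ring by the
elements `1 ⊗ x`, which come from `A`. -/
theorem finiteType_extendEvenC (A : SuperRing.{u}) (m : ℕ) :
    Hom.FiniteType (A.extendEvenC (MvPolynomial (Fin m) A.even)) := by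
  refine ⟨Set.range MvPolynomial.X, ∅, Set.finite_range _, Set.finite_empty,
    fun D γ η I hI hs _ => ?_⟩
  have heven : ∀ b, Hom.even γ b - Hom.even η b ∈ I.even := by
    intro b
    induction b using MvPolynomial.induction_on with
    | C a => exact hI.1 a
    | add p q hp hq => exact I.sub_add_mem γ η hp hq
    | mul_X p i hp => exact I.sub_mul_mem γ η hp (hs _ ⟨i, rfl⟩)
  refine ⟨heven, fun β => ?_⟩
  induction β using TensorProduct.induction_on with
  | zero =>
    have : Hom.odd γ 0 - Hom.odd η 0 = 0 := by rw [map_zero, map_zero, sub_zero]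
    exact this ▸ zero_mem I.odd
  | add x y hx hy => exact I.sub_oddAdd_mem γ η hx hy
  | tmul p x =>
    have : p ⊗ₜ[A.even] x = p • ((1 : MvPolynomial (Fin m) A.even) ⊗ₜ[A.even] x) := by
      rw [TensorProduct.smul_tmul', smul_eq_mul, mul_one]
    rw [this]
    exact I.sub_smul_mem γ η (heven p) (hI.2 x)

theorem Hom.FinitePresentation.finiteType {A B : SuperRing.{u}} {φ : A ⟶ B}
    (h : Hom.FinitePresentation φ) : Hom.FiniteType φ := by
  obtain ⟨m, n, ψ, rfl, hψ, -⟩ := h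
  exact ((finiteType_extendEvenC A m).comp (finiteType_adjoinOddsC _ n)).comp (.of_surjective hψ)

/-! ### Trivial extensions of fields -/

/-- A module over a commutative ring as the odd part of a superring in which odd elements have
product zero. -/
def ofModule (K : Type u) [CommRing K] (V : Type u) [AddCommGroup V] [Module K V] :
    SuperRing.{u} where
  even := K
  odd := V
  mul := 0
  mul_self _ := rfl
  mul_smul _ _ _ := by simp

section TrivialExtension

variable (K : Type u) [CommRing K] (V W : Type u) [AddCommGroup V] [Module K V]
  [AddCommGroup W] [Module K W]

/-- The projection `K ⊕ V → K`. -/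
def trivialEvenFst : (ofModule K V).AdjoinEven →+* K where
  toFun a := a.1
  map_one' := rfl
  map_zero' := rfl
  map_add' _ _ := rfl
  map_mul' _ _ := rfl

/-- The trivial extension `K ⊕ V ⊕ W` of `K` by the even module `V` and the odd module `W`, which
is an ideal of square zero. -/
def trivialExtension : SuperRing.{u} :=
  letI : Module (ofModule K V).AdjoinEven W := Module.compHom W (trivialEvenFst K V)
  { even := (ofModule K V).AdjoinEven
    odd := W
    mul := 0
    mul_self := fun _ => rfl
    mul_smul := fun _ _ _ => by simp }

/-- The homomorphism `K → K ⊕ V ⊕ W`. -/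
def trivialExtensionInl : ofCommRing K ⟶ trivialExtension K V W where
  even := AdjoinEven.inl (ofModule K V)
  odd := 0
  map_smul _ _ := (smul_zero _).symm
  map_mul _ _ := map_zero _

/-- The homomorphism `K ⊕ V ⊕ W → K`. -/
def trivialExtensionFst : trivialExtension K V W ⟶ ofCommRing K where
  even := trivialEvenFst K V
  odd := 0
  map_smul _ _ := rfl
  map_mul _ _ := rfl

theorem trivialExtensionInl_fst :
    trivialExtensionInl K V W ≫ trivialExtensionFst K V W = 𝟙 _ := by
  apply hom_ext
  · intro a; rfl
  · intro x; rfl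

theorem trivialExtensionFst_surjective :
    Function.Surjective (Hom.total (trivialExtensionFst K V W)) := fun x =>
  ⟨Total.mk (AdjoinEven.mk x.1 0) 0, rfl⟩

theorem trivialExtensionFst_ker_mul {x y : (trivialExtension K V W).Total}
    (hx : x ∈ RingHom.ker (Hom.total (trivialExtensionFst K V W)))
    (hy : y ∈ RingHom.ker (Hom.total (trivialExtensionFst K V W))) : x * y = 0 := by
  have hx' : x.1.1 = 0 := congrArg Prod.fst hx
  have hy' : y.1.1 = 0 := congrArg Prod.fst hy
  refine Total.ext' _ (AdjoinEven.ext' _ ?_ ?_) ?_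
  · change x.1.1 * y.1.1 + 0 = 0
    rw [hx', zero_mul, add_zero]
  · change (x.1.1 • y.1.2 + y.1.1 • x.1.2) + 0 = 0
    rw [hx', hy', zero_smul, zero_smul, add_zero, add_zero]
  · change ((show K from x.1.1) • (show W from y.2) + (show K from y.1.1) • (show W from x.2)) = 0
    rw [show (show K from x.1.1) = 0 from hx', show (show K from y.1.1) = 0 from hy', zero_smul,
      zero_smul, add_zero]

theorem isNilpotent_ker_trivialExtensionFst :
    IsNilpotent (RingHom.ker (Hom.total (trivialExtensionFst K V W))) := by
  refine ⟨2, ?_⟩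
  rw [Submodule.pow_succ, Submodule.pow_one]
  refine le_bot_iff.mp (Submodule.mul_le.mpr fun x hx y hy => ?_)
  exact trivialExtensionFst_ker_mul K V W hx hy

variable {K V W}

/-- The homomorphism `B → K ⊕ V ⊕ W` given by a homomorphism `B → K` and a derivation. -/
def toTrivialExtension (hK : IsReduced K) {B : SuperRing.{u}} (ρ : B.even →+* K) (d : B.even →+ V)
    (δ : B.odd →+ W) (hd : ∀ a b, d (a * b) = ρ a • d b + ρ b • d a)
    (hδ : ∀ a x, δ (a • x) = ρ a • δ x) (hd' : ∀ x y, d (B.mul x y) = 0) :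
    B ⟶ trivialExtension K V W where
  even :=
    { toFun b := AdjoinEven.mk (ρ b) (d b)
      map_one' := by
        refine AdjoinEven.ext' _ (map_one ρ) ?_
        -- A derivation kills `1`, since the Leibniz rule reads `d 1 = d 1 + d 1`.
        have := hd 1 1
        rw [map_one, one_smul, mul_one] at this
        exact left_eq_add.mp this
      map_zero' := AdjoinEven.ext' _ (map_zero ρ) (map_zero d)
      map_add' a b := AdjoinEven.ext' _ (map_add ρ a b) (map_add d a b)
      map_mul' a b := AdjoinEven.ext' _ (map_mul ρ a b) (hd a b) }
  odd := δ
  map_smul a x := hδ a x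
  map_mul x y := AdjoinEven.ext' _ (map_mul_eq_zero hK ρ x y) (hd' x y)

end TrivialExtension

/-! ### Uniqueness of homomorphisms into local superrings -/

/-- The quotient of `I` by a submodule containing `𝔪 I`, as a vector space over the residue field. -/
theorem exists_residue_quotient {R M : Type u} [CommRing R] [IsLocalRing R] [AddCommGroup M]
    [Module R M] (I J : Submodule R M) (h : IsLocalRing.maximalIdeal R • I ≤ J) :
    ∃ (V : Type u) (_ : AddCommGroup V) (_ : Module (IsLocalRing.ResidueField R) V) (q : I →+ V),
      (∀ r x, q (r • x) = IsLocalRing.residue R r • q x) ∧ ∀ x, q x = 0 ↔ x.1 ∈ J := by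
  let N : Submodule R I := J.submoduleOf I
  have ht : Module.IsTorsionBySet R (I ⧸ N) (IsLocalRing.maximalIdeal R) := by
    rintro x ⟨a, ha⟩
    obtain ⟨x, rfl⟩ := N.mkQ_surjective x
    rw [← map_smul]
    exact (Submodule.Quotient.mk_eq_zero N).mpr (h (Submodule.smul_mem_smul ha x.2))
  exact ⟨I ⧸ N, inferInstance, ht.module, N.mkQ.toAddMonoidHom, fun r x => map_smul N.mkQ r x,
    fun x => (Submodule.Quotient.mk_eq_zero N)⟩

/-! ### Nakayama's lemma for graded ideals of a local superring -/

section Local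

variable {D : SuperRing.{u}} (E₀ : Submodule D.even D.even) (E₁ : Submodule D.even D.odd)

/-- The graded ideal generated by an ideal of the even part and a submodule of the odd part. -/
def GradedIdeal.span : D.GradedIdeal where
  even := E₀ ⊔ Submodule.map₂ D.mul ⊤ E₁
  odd := E₁ ⊔ E₀ • (⊤ : Submodule D.even D.odd)
  mul_mem x y hy := by
    obtain ⟨y, hy', z, hz, rfl⟩ := Submodule.mem_sup.mp hy
    rw [map_add]
    refine add_mem (Submodule.mem_sup_right (Submodule.apply_mem_map₂ _ trivial hy')) (Submodule.mem_sup_left ?_)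
    have : E₀ • (⊤ : Submodule D.even D.odd) ≤ E₀.comap (D.mul x) := by
      refine Submodule.smul_le.mpr fun e he z _ => ?_
      rw [Submodule.mem_comap, map_smul, smul_eq_mul, mul_comm]
      exact E₀.smul_mem _ he
    exact this hz
  smul_mem a ha x := by
    obtain ⟨a, ha', b, hb, rfl⟩ := Submodule.mem_sup.mp ha
    rw [add_smul]
    refine add_mem (Submodule.mem_sup_right (Submodule.smul_mem_smul ha' trivial))
      (Submodule.mem_sup_left ?_)
    have : Submodule.map₂ D.mul ⊤ E₁ ≤ E₁.comap (LinearMap.toSpanSingleton D.even D.odd x) := by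
      refine Submodule.map₂_le.mpr fun z _ e he => ?_
      change D.mul z e • x ∈ E₁
      -- Two cyclic shifts, `(z e) x = (e x) z = (x z) e`, exhibit the product as an even multiple
      -- of `e`.
      rw [D.mul_smul, D.mul_smul]
      exact E₁.smul_mem _ he
    exact this hb

theorem mul_mem_maximalIdeal [IsLocalRing D.even] (x y : D.odd) :
    D.mul x y ∈ IsLocalRing.maximalIdeal D.even :=
  (IsLocalRing.residue_eq_zero_iff _).mp
    (map_mul_eq_zero inferInstance (IsLocalRing.residue D.even) x y)

variable {E₀ E₁}

/-- The components of the ideal need not be finitely generated, because `D₁` need not be, so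
Nakayama is applied to `E₀` and `E₁` only. Since `D₁ D₁ ⊆ 𝔪`, the hypotheses reduce to `E₀ ⊆ D₁ E₁ +
𝔪 E₀` and `E₁ ⊆ E₀ D₁ + 𝔪 E₁`. Hence `E₀ ⊆ D₁ E₁` and `E₁ ⊆ E₀ D₁`, so `E₀ ⊆ D₁ E₀ D₁ ⊆ 𝔪 E₀`, and a
last use of Nakayama gives `E₀ = 0`. -/
theorem GradedIdeal.span_eq_bot [IsLocalRing D.even] (h₀ : E₀.FG) (h₁ : E₁.FG)
    (H₀ : E₀ ≤ Submodule.map₂ D.mul ⊤ (span E₀ E₁).odd ⊔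
      IsLocalRing.maximalIdeal D.even • (span E₀ E₁).even)
    (H₁ : E₁ ≤ (span E₀ E₁).even • (⊤ : Submodule D.even D.odd) ⊔
      IsLocalRing.maximalIdeal D.even • (span E₀ E₁).odd) :
    (span E₀ E₁).even = ⊥ ∧ (span E₀ E₁).odd = ⊥ := by
  have hjac : IsLocalRing.maximalIdeal D.even ≤ Ideal.jacobson ⊥ :=
    IsLocalRing.maximalIdeal_le_jacobson _
  have hmul : Submodule.map₂ D.mul ⊤ (E₀ • (⊤ : Submodule D.even D.odd)) ≤
      IsLocalRing.maximalIdeal D.even • E₀ := by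
    refine Submodule.map₂_le.mpr fun x _ => ?_
    suffices E₀ • (⊤ : Submodule D.even D.odd) ≤
      (IsLocalRing.maximalIdeal D.even • E₀).comap (D.mul x) from fun y hy => this hy
    refine Submodule.smul_le.mpr fun e he z _ => ?_
    rw [Submodule.mem_comap, map_smul, smul_eq_mul e, mul_comm e]
    exact Submodule.smul_mem_smul (mul_mem_maximalIdeal x z) he
  have hle₀ : E₀ ≤ Submodule.map₂ D.mul ⊤ E₁ := by
    refine Submodule.le_of_le_smul_of_le_jacobson_bot h₀ hjac (H₀.trans (sup_le ?_ ?_))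
    · refine (Submodule.map₂_sup_right _ _ _ _).le.trans (sup_le le_sup_left ?_)
      exact hmul.trans le_sup_right
    · refine (Submodule.smul_sup _ _ _).le.trans (sup_le le_sup_right ?_)
      exact Submodule.smul_le_right.trans le_sup_left
  have hle₁ : E₁ ≤ E₀ • (⊤ : Submodule D.even D.odd) := by
    refine Submodule.le_of_le_smul_of_le_jacobson_bot h₁ hjac (H₁.trans (sup_le ?_ ?_))
    · refine (Submodule.sup_smul _ _ _).le.trans (sup_le le_sup_left ?_)
      refine le_trans ?_ le_sup_right
      refine Submodule.smul_le.mpr fun a ha x _ => ?_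
      have : Submodule.map₂ D.mul ⊤ E₁ ≤ (IsLocalRing.maximalIdeal D.even • E₁).comap
          (LinearMap.toSpanSingleton D.even D.odd x) := by
        refine Submodule.map₂_le.mpr fun z _ e he => ?_
        change D.mul z e • x ∈ IsLocalRing.maximalIdeal D.even • E₁
        rw [D.mul_smul, D.mul_smul]
        exact Submodule.smul_mem_smul (mul_mem_maximalIdeal x z) he
      exact this ha
    · refine (Submodule.smul_sup _ _ _).le.trans (sup_le le_sup_right ?_)
      exact Submodule.smul_le_right.trans le_sup_left
  have hbot : E₀ = ⊥ := Submodule.eq_bot_of_le_smul_of_le_jacobson_bot _ _ h₀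
    (hle₀.trans ((Submodule.map₂_le_map₂_right hle₁).trans hmul)) hjac
  subst hbot
  rw [Submodule.bot_smul, le_bot_iff] at hle₁
  subst hle₁
  exact ⟨by simp [span], by simp [span]⟩

end Local

/-- Homomorphisms from a superring `B` of finite type over `A` to a local superring are equal if
they agree on `A` and the homomorphisms from `B` to trivial extensions of fields are determined by
their restriction to `A`, whenever the latter has values in the field. -/
theorem hom_eq_of_isLocalRing {A B D : SuperRing.{u}} {φ : A ⟶ B} (hφ : Hom.FiniteType φ)
    (H : ∀ (K V W : Type u) [Field K] [AddCommGroup V] [Module K V] [AddCommGroup W] [Module K W]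
      (χ χ' : B ⟶ trivialExtension K V W) (ρ : A ⟶ ofCommRing K),
      φ ≫ χ = ρ ≫ trivialExtensionInl K V W → φ ≫ χ' = ρ ≫ trivialExtensionInl K V W → χ = χ')
    [IsLocalRing D.even] (γ η : B ⟶ D) (h : φ ≫ γ = φ ≫ η) : γ = η := by
  let K := IsLocalRing.ResidueField D.even
  have hA₀ (a) : Hom.even γ (Hom.even φ a) = Hom.even η (Hom.even φ a) :=
    congrArg (fun f => Hom.even f a) h
  have hA₁ (a) : Hom.odd γ (Hom.odd φ a) = Hom.odd η (Hom.odd φ a) :=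
    congrArg (fun f => Hom.odd f a) h
  let res (θ : B ⟶ D) : B.even →+* K := (IsLocalRing.residue D.even).comp (Hom.even θ)
  let ρ : A ⟶ ofCommRing K := Hom.ofReduced (inferInstanceAs (IsReduced K))
    ((res γ).comp (Hom.even φ))
  -- With zero modules the trivial extension is just `K`, so the hypothesis compares the two
  -- reductions modulo the maximal ideal.
  have hres : res γ = res η := by
    let χ (θ : B ⟶ D) : B ⟶ trivialExtension K PUnit.{u + 1} PUnit.{u + 1} :=
      toTrivialExtension inferInstance (res θ) 0 0 (fun _ _ => rfl) (fun _ _ => rfl) (fun _ _ => rfl)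
    have := H K PUnit PUnit (χ γ) (χ η) ρ (hom_ext (fun a => rfl) (fun _ => rfl))
      (hom_ext (fun a => AdjoinEven.ext' _ (congrArg (IsLocalRing.residue D.even) (hA₀ a).symm) rfl)
        (fun _ => rfl))
    ext b
    exact congrArg (fun f => (show (ofModule K PUnit.{u + 1}).AdjoinEven from Hom.even f b).1) this
  obtain ⟨s, t, hs, ht, hst⟩ := hφ
  let E₀ : Submodule D.even D.even := Submodule.span _ ((fun b => Hom.even γ b - Hom.even η b) '' s)
  let E₁ : Submodule D.even D.odd := Submodule.span _ ((fun b => Hom.odd γ b - Hom.odd η b) '' t)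
  let I := GradedIdeal.span E₀ E₁
  have hI : I.Congr γ η := by
    refine hst γ η I ⟨fun a => ?_, fun a => ?_⟩ (fun b hb => ?_) (fun b hb => ?_)
    · rw [h, sub_self]; exact zero_mem _
    · rw [h, sub_self]; exact zero_mem _
    · exact Submodule.mem_sup_left (Submodule.subset_span ⟨b, hb, rfl⟩)
    · exact Submodule.mem_sup_left (Submodule.subset_span ⟨b, hb, rfl⟩)
  -- Besides `𝔪 I`, the products of `I` with odd elements are divided out: odd elements of a trivial
  -- extension annihilate each other and the even module `V`.
  obtain ⟨V, _, _, p, hp, hp'⟩ := exists_residue_quotient I.even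
    (Submodule.map₂ D.mul ⊤ I.odd ⊔ IsLocalRing.maximalIdeal D.even • I.even) le_sup_right
  obtain ⟨W, _, _, q, hq, hq'⟩ := exists_residue_quotient I.odd
    (I.even • (⊤ : Submodule D.even D.odd) ⊔ IsLocalRing.maximalIdeal D.even • I.odd) le_sup_right
  let d : B.even →+ V := p.comp
    { toFun b := ⟨Hom.even γ b - Hom.even η b, hI.1 b⟩
      map_zero' := Subtype.ext (by simp)
      map_add' a b := Subtype.ext (by simp [add_sub_add_comm]) }
  let δ : B.odd →+ W := q.comp
    { toFun b := ⟨Hom.odd γ b - Hom.odd η b, hI.2 b⟩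
      map_zero' := Subtype.ext (by simp)
      map_add' a b := Subtype.ext (by simp [add_sub_add_comm]) }
  have hd (a b) : d (a * b) = res γ a • d b + res γ b • d a := by
    have : (⟨Hom.even γ (a * b) - Hom.even η (a * b), hI.1 _⟩ : I.even) =
        Hom.even γ a • ⟨Hom.even γ b - Hom.even η b, hI.1 b⟩ +
          Hom.even η b • ⟨Hom.even γ a - Hom.even η a, hI.1 a⟩ :=
      Subtype.ext (Hom.even_mul_sub γ η a b)
    refine (congrArg p this).trans ?_
    rw [map_add, hp, hp]
    refine congrArg₂ (· + ·) rfl (congrArg₂ (· • ·) ?_ rfl)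
    exact (RingHom.congr_fun hres b).symm
  have hδ (a x) : δ (a • x) = res γ a • δ x := by
    have hmem : (Hom.even γ a - Hom.even η a) • Hom.odd η x ∈ I.odd := I.smul_mem _ (hI.1 a) _
    have : (⟨Hom.odd γ (a • x) - Hom.odd η (a • x), hI.2 _⟩ : I.odd) =
        Hom.even γ a • ⟨Hom.odd γ x - Hom.odd η x, hI.2 x⟩ + ⟨_, hmem⟩ :=
      Subtype.ext (Hom.odd_smul_sub γ η a x)
    refine (congrArg q this).trans ?_
    rw [map_add, hq, (hq' ⟨_, hmem⟩).mpr, add_zero]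
    · rfl
    · exact Submodule.mem_sup_left (Submodule.smul_mem_smul (hI.1 a) trivial)
  have hd' (x y) : d (B.mul x y) = 0 := by
    refine (hp' _).mpr (Submodule.mem_sup_left ?_)
    change Hom.even γ (B.mul x y) - Hom.even η (B.mul x y) ∈ _
    rw [Hom.even_oddMul_sub]
    exact sub_mem (Submodule.apply_mem_map₂ _ trivial (hI.2 y))
      (Submodule.apply_mem_map₂ _ trivial (hI.2 x))
  -- The zero derivation and `(d, δ)` both restrict on `A` to the map through `K`, because all
  -- differences vanish there; equality says `d = 0` and `δ = 0`.
  have hχ := H K V W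
    (toTrivialExtension inferInstance (res γ) 0 0 (fun a b => by simp) (fun a b => by simp)
      (fun _ _ => rfl))
    (toTrivialExtension inferInstance (res γ) d δ hd hδ hd') ρ
    (hom_ext (fun a => rfl) (fun _ => rfl))
    (hom_ext (fun a => AdjoinEven.ext' _ rfl ((hp' _).mpr (by
        change Hom.even γ (Hom.even φ a) - Hom.even η (Hom.even φ a) ∈ _
        rw [hA₀, sub_self]; exact zero_mem _)))
      (fun a => (hq' _).mpr (by
        change Hom.odd γ (Hom.odd φ a) - Hom.odd η (Hom.odd φ a) ∈ _
        rw [hA₁, sub_self]; exact zero_mem _)))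
  have hbot : I.even = ⊥ ∧ I.odd = ⊥ := by
    refine GradedIdeal.span_eq_bot (Submodule.fg_span (hs.image _)) (Submodule.fg_span (ht.image _))
      (Submodule.span_le.mpr ?_) (Submodule.span_le.mpr ?_)
    · rintro _ ⟨b, -, rfl⟩
      refine (hp' ⟨_, hI.1 b⟩).mp ?_
      exact (congrArg (fun f => (show (ofModule K V).AdjoinEven from Hom.even f b).2) hχ).symm
    · rintro _ ⟨b, -, rfl⟩
      refine (hq' ⟨_, hI.2 b⟩).mp ?_
      exact (congrArg (fun f => (show W from Hom.odd f b)) hχ).symm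
  refine hom_ext (fun b => sub_eq_zero.mp ?_) (fun b => sub_eq_zero.mp ?_)
  · exact (Submodule.mem_bot _).mp (hbot.1 ▸ hI.1 b)
  · exact (Submodule.mem_bot _).mp (hbot.2 ▸ hI.2 b)

end SuperRing

namespace SuperRing

/-! ### Homomorphisms out of the stalks -/

/-- A homomorphism from the stalk of `Y` at `y` to a superring `D`, as a compatible family of
homomorphisms from the sections over the open neighbourhoods of `y`. -/
structure StalkHom (Y : PresheafedSpace SuperRing.{u}) (y : Y) (D : SuperRing.{u}) where
  app (U : Opens Y) (h : y ∈ U) : Y.presheaf.obj (op U) ⟶ D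
  map_app {U V : Opens Y} (i : U ⟶ V) (h : y ∈ U) :
    Y.presheaf.map i.op ≫ app U h = app V (i.le h)

namespace StalkHom

theorem ext' {Y : PresheafedSpace SuperRing.{u}} {y : Y} {D : SuperRing.{u}} {p q : StalkHom Y y D}
    (h : ∀ U hU, p.app U hU = q.app U hU) : p = q := by
  cases p; cases q
  congr
  funext U hU
  exact h U hU

variable {X Y Z : PresheafedSpace SuperRing.{u}} {D : SuperRing.{u}}

/-- The composition with the map on stalks of a morphism. -/
def push (F : Y ⟶ Z) {y : Y} (p : StalkHom Y y D) {z : Z} (hz : F.base y = z) : StalkHom Z z D where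
  app U h := F.c.app (op U) ≫ p.app ((Opens.map F.base).obj U) (by subst hz; exact h)
  map_app {U V} i h := by
    rw [F.c.naturality_assoc]
    exact congrArg _ (p.map_app ((Opens.map F.base).map i) _)

theorem push_comp (F : X ⟶ Y) (G : Y ⟶ Z) {x : X} (p : StalkHom X x D) {y : Y} (hy : F.base x = y)
    {z : Z} (hz : G.base y = z) (hz' : (F ≫ G).base x = z) :
    push (F ≫ G) p hz' = push G (push F p hy) hz :=
  ext' fun U _ =>
    Category.assoc (G.c.app (op U)) (F.c.app (op ((Opens.map G.base).obj U)))
      (p.app ((Opens.map F.base).obj ((Opens.map G.base).obj U)) _)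

theorem push_congr {F G : Y ⟶ Z} (h : F = G) {y : Y} (p : StalkHom Y y D) {z : Z}
    (hz : F.base y = z) (hz' : G.base y = z) : push F p hz = push G p hz' := by
  subst h; rfl

/-! ### Homomorphisms from stalks under open immersions -/

section OpenImmersion

variable (j : Y ⟶ Z) [PresheafedSpace.IsOpenImmersion j] {y : Y}

/-- Sections over `U` are identified by `invApp` with sections over its open image, so `p` can be
read off from its push-forward. -/
theorem push_injective {z : Z} (hz : j.base y = z) {p q : StalkHom Y y D}
    (h : push j p hz = push j q hz) : p = q := by
  subst hz
  refine ext' fun U hU => ?_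
  have key (p : StalkHom Y y D) : p.app U hU = PresheafedSpace.IsOpenImmersion.invApp j U ≫
      (push j p rfl).app ((PresheafedSpace.IsOpenImmersion.opensFunctor j).obj U)
        ⟨y, hU, rfl⟩ := by
    change _ = _ ≫ _ ≫ _
    rw [PresheafedSpace.IsOpenImmersion.invApp_app_assoc]
    have := p.map_app (U := (Opens.map j.base).obj
      ((PresheafedSpace.IsOpenImmersion.opensFunctor j).obj U)) (V := U) (eqToHom (by
        ext x
        simp [PresheafedSpace.IsOpenImmersion.base_open.injective.mem_set_image])) ⟨y, hU, rfl⟩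
    rw [← this]
    congr 2
    exact Subsingleton.elim _ _
  rw [key p, key q, h]

theorem exists_push {z : Z} (hz : j.base y = z) (p : StalkHom Z z D) :
    ∃ q : StalkHom Y y D, push j q hz = p := by
  subst hz
  refine ⟨⟨fun U hU => PresheafedSpace.IsOpenImmersion.invApp j U ≫
    p.app ((PresheafedSpace.IsOpenImmersion.opensFunctor j).obj U) ⟨y, hU, rfl⟩,
    fun {U V} i h => ?_⟩, ext' fun U hU => ?_⟩
  · have := PresheafedSpace.IsOpenImmersion.inv_naturality j i.op
    change Y.presheaf.map i.op ≫ PresheafedSpace.IsOpenImmersion.invApp j U = _ at this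
    rw [reassoc_of% this]
    congr 1
    exact p.map_app ((PresheafedSpace.IsOpenImmersion.opensFunctor j).map i) _
  · change _ ≫ _ ≫ _ = _
    rw [PresheafedSpace.IsOpenImmersion.app_invApp_assoc]
    exact p.map_app _ _

end OpenImmersion

end StalkHom

/-! ### Sections of the spectrum -/

section Sections

open StructureSheaf

variable (B : SuperRing.{u})

/-- The canonical homomorphism from `B` to the sections of its spectrum. -/
noncomputable def toSections (U : Opens (PrimeSpectrum.Top B.even)) : B ⟶ B.sections (op U) where
  even := algebraMap B.even (B.EvenSections (op U))
  odd := (toOpenₗ B.even B.odd U).toAddMonoidHom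
  map_smul a x := by
    change toOpenₗ B.even B.odd U (a • x) =
      algebraMap B.even (B.EvenSections (op U)) a • toOpenₗ B.even B.odd U x
    rw [map_smul, algebraMap_smul]
  map_mul x y := Subtype.ext <| funext fun p =>
    (by rw [mul_one]; rfl : _ = LocalizedModule.mk (B.mul x y) (1 * 1)).trans
      (primeMul_mk p.1 x y 1 1).symm

/-- Separates a fraction into `1 / g` and a global element, which `StalkHom.ext_spec` treats by
different arguments. -/
theorem const_one_mul_algebraMap (g : B.even) (U : Opens (PrimeSpectrum.Top B.even))
    (hU : U ≤ PrimeSpectrum.basicOpen g) (f : B.even) :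
    (const 1 g U hU : B.EvenSections (op U)) * algebraMap B.even _ f = const f g U hU := 
  (mul_comm _ _).trans ((Algebra.smul_def _ _).symm.trans
    ((smul_const 1 f g U hU).trans (const_congr (mul_one f) rfl)))

theorem const_one_smul (g : B.even) (U : Opens (PrimeSpectrum.Top B.even))
    (hU : U ≤ PrimeSpectrum.basicOpen g) (x : B.odd) :
    (const 1 g U hU : B.EvenSections (op U)) • toOpenₗ B.even B.odd U x = const x g U hU :=
  Subtype.ext <| funext fun _ => (LocalizedModule.mk_smul_mk ..).trans
    (congrArg₂ LocalizedModule.mk (one_smul _ x) (mul_one _))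

variable {B}

/-- Near `q` every section is a fraction `f / g`. The value on `f` is prescribed by the hypothesis,
and the value on `1 / g` is then forced because inverses are unique. -/
theorem StalkHom.ext_spec {D : SuperRing.{u}} {q : B.specPresheafedSpace}
    {p p' : StalkHom B.specPresheafedSpace q D}
    (h : B.toSections ⊤ ≫ p.app ⊤ trivial = B.toSections ⊤ ≫ p'.app ⊤ trivial) : p = p' := by
  have hres (p : StalkHom B.specPresheafedSpace q D) (U) (hU : q ∈ U) :
      B.toSections U ≫ p.app U hU = B.toSections ⊤ ≫ p.app ⊤ trivial :=
    (Category.assoc (B.toSections ⊤) (B.structurePresheaf.map (homOfLE le_top : U ⟶ ⊤).op)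
      (p.app U hU)).trans (congrArg (B.toSections ⊤ ≫ ·) (p.map_app (homOfLE le_top) hU))
  have hU (U) (hU : q ∈ U) : B.toSections U ≫ p.app U hU = B.toSections U ≫ p'.app U hU := by
    rw [hres, hres, h]
  have hconst (g : B.even) (hg : q ∈ PrimeSpectrum.basicOpen g) :
      Hom.even (p.app _ hg) (const 1 g _ le_rfl) = Hom.even (p'.app _ hg) (const 1 g _ le_rfl) := by
    have key : (const 1 g (PrimeSpectrum.basicOpen g) le_rfl : B.EvenSections (op _)) *
      algebraMap B.even _ g = 1 :=
      (const_one_mul_algebraMap B g _ le_rfl g).trans (const_self g _ _)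
    have key' (p : StalkHom B.specPresheafedSpace q D) :
        Hom.even (p.app _ hg) (const 1 g _ le_rfl) *
          Hom.even (p.app _ hg) (algebraMap B.even (B.EvenSections (op _)) g) = 1 :=
      (map_mul _ _ _).symm.trans ((congrArg _ key).trans (map_one _))
    refine (left_inv_eq_right_inv (key' p) ?_)
    have := congrArg (fun f => Hom.even f g) (hU _ hg)
    refine (congrArg₂ (· * ·) this rfl).trans ?_
    rw [mul_comm]
    exact key' p'
  refine ext' fun U hqU => hom_ext (fun s => ?_) (fun s => ?_)
  · obtain ⟨g, hg, i, f, hs⟩ := exists_const U s q hqU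
    have key (p : StalkHom B.specPresheafedSpace q D) : Hom.even (p.app U hqU) s =
        Hom.even (p.app _ hg) (const 1 g _ le_rfl) *
          Hom.even (p.app _ hg) (algebraMap B.even (B.EvenSections (op _)) f) := by
      rw [← p.map_app i.hom hg, comp_even]
      refine (congrArg _ hs.symm).trans (Eq.trans ?_ (map_mul _ _ _))
      exact congrArg _ (const_one_mul_algebraMap B g _ le_rfl f).symm
    rw [key p, key p', hconst g hg]
    exact congrArg _ (congrArg (fun φ => Hom.even φ f) (hU _ hg))
  · obtain ⟨g, hg, i, f, hs⟩ := exists_const U s q hqU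
    have key (p : StalkHom B.specPresheafedSpace q D) : Hom.odd (p.app U hqU) s =
        Hom.even (p.app _ hg) (const 1 g _ le_rfl) •
          Hom.odd (p.app _ hg) (toOpenₗ B.even B.odd _ f) := by
      rw [← p.map_app i.hom hg, comp_odd]
      refine (congrArg _ hs.symm).trans (Eq.trans ?_ (Hom.map_smul _ _ _))
      exact congrArg _ (const_one_smul B g _ le_rfl f).symm
    rw [key p, key p', hconst g hg]
    exact congrArg _ (congrArg (fun φ => Hom.odd φ f) (hU _ hg))

theorem toSections_specMap {A B : SuperRing.{u}} (φ : A ⟶ B) :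
    A.toSections ⊤ ≫ (Hom.specMap φ).c.app (op ⊤) = φ ≫ B.toSections ⊤ := by
  refine hom_ext (fun a => Subtype.ext <| funext fun p => ?_)
    (fun x => Subtype.ext <| funext fun p => ?_)
  · refine (Localizations.comapFun_mk (Hom.even φ).toSemilinearMap p.1 a 1).trans ?_
    exact congrArg (LocalizedModule.mk _) (Subtype.ext (map_one _))
  · refine (Localizations.comapFun_mk (Hom.oddₛₗ φ) p.1 x 1).trans ?_
    exact congrArg (LocalizedModule.mk _) (Subtype.ext (map_one _))

/-- The localization of a superring at a prime ideal of the even part. -/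
noncomputable def atPrime (C : SuperRing.{u}) (P : PrimeSpectrum C.even) : SuperRing.{u} where
  even := Localizations C.even P
  odd := Localizations C.odd P
  mul := LinearMap.mk₂ _ (C.primeMul P) (primeMul_add_left P) (primeMul_smul_left P)
    (primeMul_add_right P) (primeMul_smul_right P)
  mul_self := primeMul_self P
  mul_smul := primeMul_smul P

instance instIsLocalRingAtPrime (C : SuperRing.{u}) (P : PrimeSpectrum C.even) :
    IsLocalRing (C.atPrime P).even :=
  IsLocalization.AtPrime.isLocalRing (Localizations C.even P) P.asIdeal

/-- The evaluation of sections at a prime ideal. -/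
noncomputable def evalStalk (C : SuperRing.{u}) (P : C.specPresheafedSpace) :
    StalkHom C.specPresheafedSpace P (C.atPrime P) where
  app _ h :=
    { even :=
        { toFun s := s.1 ⟨P, h⟩
          map_one' := rfl
          map_zero' := rfl
          map_add' _ _ := rfl
          map_mul' _ _ := rfl }
      odd :=
        { toFun s := s.1 ⟨P, h⟩
          map_zero' := rfl
          map_add' _ _ := rfl }
      map_smul _ _ := rfl
      map_mul _ _ := rfl }
  map_app _ _ := rfl

end Sections

end SuperRing

namespace Superscheme

open SuperRing

/-! ### Morphisms are determined on stalks -/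

theorem exists_chart (T : Superscheme.{u}) (t : T) :
    ∃ (C : SuperRing.{u}) (i : C.specPresheafedSpace ⟶ T.toPresheafedSpace),
      PresheafedSpace.IsOpenImmersion i ∧ t ∈ Set.range i.base := by
  obtain ⟨U, C, ⟨e⟩⟩ := T.local_affine t
  let y : T.toPresheafedSpace.restrict U.isOpenEmbedding := ⟨t, U.2⟩
  refine ⟨C, e.inv ≫ T.toPresheafedSpace.ofRestrict U.isOpenEmbedding, ?_, e.hom.base y, ?_⟩
  · have : PresheafedSpace.IsOpenImmersion e.inv :=
      PresheafedSpace.IsOpenImmersion.ofIso e.symm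
    infer_instance
  · have h : e.hom ≫ e.inv ≫ T.toPresheafedSpace.ofRestrict U.isOpenEmbedding =
        T.toPresheafedSpace.ofRestrict U.isOpenEmbedding := by
      rw [e.hom_inv_id_assoc]
    exact congrArg (fun f => (PresheafedSpace.Hom.base f) y) h

/-- Sections that have the same image under all homomorphisms from the stalks to local superrings
are equal near every point. -/
theorem exists_restrict_eq {T : Superscheme.{u}} (W : Opens T) (t : T) (ht : t ∈ W) :
    ∃ (V : Opens T) (i : V ⟶ W), t ∈ V ∧
      (∀ s s' : (T.toPresheafedSpace.presheaf.obj (op W)).even,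
        (∀ (x : T) (hx : x ∈ W) (D : SuperRing.{u}) [IsLocalRing D.even]
          (p : StalkHom T.toPresheafedSpace x D),
            SuperRing.Hom.even (p.app W hx) s = SuperRing.Hom.even (p.app W hx) s') →
        SuperRing.Hom.even (T.toPresheafedSpace.presheaf.map i.op) s =
          SuperRing.Hom.even (T.toPresheafedSpace.presheaf.map i.op) s') ∧
      (∀ s s' : (T.toPresheafedSpace.presheaf.obj (op W)).odd,
        (∀ (x : T) (hx : x ∈ W) (D : SuperRing.{u}) [IsLocalRing D.even]
          (p : StalkHom T.toPresheafedSpace x D),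
            SuperRing.Hom.odd (p.app W hx) s = SuperRing.Hom.odd (p.app W hx) s') →
        SuperRing.Hom.odd (T.toPresheafedSpace.presheaf.map i.op) s =
          SuperRing.Hom.odd (T.toPresheafedSpace.presheaf.map i.op) s') := by
  obtain ⟨C, i, hi, P, rfl⟩ := T.exists_chart t
  refine ⟨(PresheafedSpace.IsOpenImmersion.opensFunctor i).obj ((Opens.map i.base).obj W),
    homOfLE (Set.image_preimage_subset i.base W.1), ⟨P, ht, rfl⟩, fun s s' h => ?_, fun s s' h => ?_⟩
  -- The restriction factors through the sections on the chart, which are families of elements of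
  -- localizations; evaluation at the primes `Q` therefore separates them.
  · have key := fun s => congrArg (fun f => SuperRing.Hom.even f s)
      (PresheafedSpace.IsOpenImmersion.app_invApp i W)
    refine (key s).symm.trans (Eq.trans ?_ (key s'))
    refine congrArg (SuperRing.Hom.even (PresheafedSpace.IsOpenImmersion.invApp i _)) ?_
    refine Subtype.ext (funext fun Q => ?_)
    have : IsLocalRing (C.atPrime Q.1).even := instIsLocalRingAtPrime C Q.1
    exact h (i.base Q.1) Q.2 (C.atPrime Q.1) (StalkHom.push i (C.evalStalk Q.1) rfl)
  · have key := fun s => congrArg (fun f => SuperRing.Hom.odd f s)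
      (PresheafedSpace.IsOpenImmersion.app_invApp i W)
    refine (key s).symm.trans (Eq.trans ?_ (key s'))
    refine congrArg (SuperRing.Hom.odd (PresheafedSpace.IsOpenImmersion.invApp i _)) ?_
    refine Subtype.ext (funext fun Q => ?_)
    have : IsLocalRing (C.atPrime Q.1).even := instIsLocalRingAtPrime C Q.1
    exact h (i.base Q.1) Q.2 (C.atPrime Q.1) (StalkHom.push i (C.evalStalk Q.1) rfl)

theorem even_ext {T : Superscheme.{u}} {W : Opens T}
    {s s' : (T.toPresheafedSpace.presheaf.obj (op W)).even}
    (h : ∀ (x : T) (hx : x ∈ W) (D : SuperRing.{u}) [IsLocalRing D.even]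
      (p : StalkHom T.toPresheafedSpace x D),
        SuperRing.Hom.even (p.app W hx) s = SuperRing.Hom.even (p.app W hx) s') : s = s' := by
  choose V i hV he _ using fun t : W => exists_restrict_eq W t.1 t.2
  exact TopCat.Sheaf.eq_of_locally_eq' ⟨_, T.isSheaf_even⟩ V W i
    (fun t ht => Opens.mem_iSup.mpr ⟨⟨t, ht⟩, hV _⟩) s s' fun t => he t s s' h

theorem odd_ext {T : Superscheme.{u}} {W : Opens T}
    {s s' : (T.toPresheafedSpace.presheaf.obj (op W)).odd}
    (h : ∀ (x : T) (hx : x ∈ W) (D : SuperRing.{u}) [IsLocalRing D.even]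
      (p : StalkHom T.toPresheafedSpace x D),
        SuperRing.Hom.odd (p.app W hx) s = SuperRing.Hom.odd (p.app W hx) s') : s = s' := by
  choose V i hV _ ho using fun t : W => exists_restrict_eq W t.1 t.2
  exact TopCat.Sheaf.eq_of_locally_eq' (C := Type u) ⟨_, T.isSheaf_odd⟩ V W i
    (fun t ht => Opens.mem_iSup.mpr ⟨⟨t, ht⟩, hV _⟩) s s' fun t => ho t s s' h

/-- Evaluations at primes of affine charts already separate sections, so test targets can be
restricted to local superrings, where Nakayama's lemma is available. -/
theorem hom_ext_stalk {T X : Superscheme.{u}} {g h : T ⟶ X}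
    (hb : ∀ t, (Hom.toHom g).base t = (Hom.toHom h).base t)
    (H : ∀ (t : T) (D : SuperRing.{u}) [IsLocalRing D.even]
      (p : StalkHom T.toPresheafedSpace t D),
        StalkHom.push (Hom.toHom g) p (hb t) = StalkHom.push (Hom.toHom h) p rfl) : g = h := by
  obtain ⟨⟨b, c⟩, _⟩ := g
  obtain ⟨⟨b', c'⟩, _⟩ := h
  obtain rfl : b = b' := TopCat.hom_ext (ContinuousMap.ext hb)
  refine Hom.ext' (congrArg (PresheafedSpace.Hom.mk b) (NatTrans.ext (funext fun U => ?_)))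
  have key (t : T) (ht : b t ∈ U.unop) (D : SuperRing.{u}) [IsLocalRing D.even]
      (p : StalkHom T.toPresheafedSpace t D) :
      c.app U ≫ p.app ((Opens.map b).obj U.unop) ht =
        c'.app U ≫ p.app ((Opens.map b).obj U.unop) ht :=
    congrArg (fun q => StalkHom.app q U.unop ht) (H t D p)
  refine SuperRing.hom_ext (fun s => ?_) (fun s => ?_)
  · exact even_ext fun t ht D _ p => congrArg (fun f => SuperRing.Hom.even f s) (key t ht D p)
  · exact odd_ext fun t ht D _ p => congrArg (fun f => SuperRing.Hom.odd f s) (key t ht D p)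

/-! ### Functoriality of the spectrum -/

/-- Together with `StalkHom.ext_spec`, this turns comparisons of morphisms of spectra into
comparisons of homomorphisms of superrings. -/
theorem toSections_push {A B D : SuperRing.{u}} (φ : A ⟶ B) {q : B.specPresheafedSpace}
    (p : StalkHom B.specPresheafedSpace q D) {q' : A.specPresheafedSpace}
    (h : (SuperRing.Hom.specMap φ).base q = q') :
    A.toSections ⊤ ≫ (StalkHom.push (SuperRing.Hom.specMap φ) p h).app ⊤ trivial =
      φ ≫ B.toSections ⊤ ≫ p.app ⊤ trivial :=
  (Category.assoc (A.toSections ⊤) ((SuperRing.Hom.specMap φ).c.app (op ⊤))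
    (p.app ⊤ trivial)).symm.trans ((congrArg (· ≫ p.app ⊤ trivial) (toSections_specMap φ)).trans
      (Category.assoc _ _ _))

theorem Spec.map_comp {A B C : SuperRing.{u}} (φ : A ⟶ B) (ψ : B ⟶ C) :
    Spec.map (φ ≫ ψ) = Spec.map ψ ≫ Spec.map φ := by
  refine hom_ext_stalk (fun _ => rfl) fun t D _ p => StalkHom.ext_spec ?_
  have : StalkHom.push (Hom.toHom (Spec.map ψ ≫ Spec.map φ)) p rfl =
    StalkHom.push (SuperRing.Hom.specMap φ) (StalkHom.push (SuperRing.Hom.specMap ψ) p rfl) rfl :=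
    StalkHom.push_comp _ _ p rfl rfl rfl
  rw [this]
  refine (toSections_push (φ ≫ ψ) p rfl).trans (Eq.symm ((toSections_push φ _ rfl).trans ?_))
  rw [toSections_push ψ p rfl, Category.assoc]

theorem Spec.map_id (A : SuperRing.{u}) : Spec.map (𝟙 A) = 𝟙 _ := by
  refine hom_ext_stalk (fun _ => rfl) fun t D _ p => StalkHom.ext_spec ?_
  exact (toSections_push (𝟙 A) p rfl).trans (Category.id_comp _)

/-- A superring embeds into the global sections of its spectrum, which are determined by their
values at all primes. -/
theorem Spec.map_injective {A B : SuperRing.{u}} {φ ψ : A ⟶ B} (h : Spec.map φ = Spec.map ψ) :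
    φ = ψ := by
  have key (P : B.specPresheafedSpace) : φ ≫ B.toSections ⊤ ≫ (B.evalStalk P).app ⊤ trivial =
      ψ ≫ B.toSections ⊤ ≫ (B.evalStalk P).app ⊤ trivial := by
    have hb : (SuperRing.Hom.specMap φ).base P = (SuperRing.Hom.specMap ψ).base P :=
      congrArg (fun f => (Hom.toHom f).base P) h
    exact (toSections_push φ (B.evalStalk P) hb).symm.trans
      ((congrArg (fun p => A.toSections ⊤ ≫ p.app ⊤ trivial)
        (StalkHom.push_congr (congrArg Hom.toHom h) (B.evalStalk P) hb rfl)).trans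
          (toSections_push ψ (B.evalStalk P) rfl))
  refine SuperRing.hom_ext (fun a => ?_) (fun a => ?_)
  · refine StructureSheaf.algebraMap_obj_top_bijective.1 (Subtype.ext (funext fun P => ?_))
    exact congrArg (fun f => SuperRing.Hom.even f a) (key P.1)
  · refine (StructureSheaf.toOpenₗ_top_bijective (R := B.even) (M := B.odd)).1 (Subtype.ext (funext fun P => ?_))
    exact congrArg (fun f => SuperRing.Hom.odd f a) (key P.1)

/-! ### A criterion for monomorphisms -/

/-- Two `S`-morphisms to `X` from the spectrum of a trivial extension `K ⊕ V ⊕ W` of a field `K` are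
equal if the structure morphism to `S` factors through the spectrum of `K`. -/
def InjectiveOnTrivialExtensions {X S : Superscheme.{u}} (f : X ⟶ S) : Prop :=
  ∀ (K V W : Type u) [Field K] [AddCommGroup V] [Module K V] [AddCommGroup W] [Module K W]
    (a b : Spec (trivialExtension K V W) ⟶ X) (c : Spec (ofCommRing K) ⟶ S),
    a ≫ f = Spec.map (trivialExtensionInl K V W) ≫ c →
    b ≫ f = Spec.map (trivialExtensionInl K V W) ≫ c → a = b

/-- Take `V = W = 0` and pull back to `Spec (K ⊕ 0 ⊕ 0)`; the morphism from there to `Spec K` has a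
section, so it can be cancelled. -/
theorem InjectiveOnTrivialExtensions.eq_of_field {X S : Superscheme.{u}} {f : X ⟶ S}
    (H : InjectiveOnTrivialExtensions f) {K : Type u} [Field K] {a b : Spec (ofCommRing K) ⟶ X}
    (h : a ≫ f = b ≫ f) : a = b := by
  have := H K PUnit PUnit (Spec.map (trivialExtensionInl _ _ _) ≫ a)
    (Spec.map (trivialExtensionInl _ _ _) ≫ b) (a ≫ f) (by rw [Category.assoc])
    (by rw [Category.assoc, h])
  have h' (a : Spec (ofCommRing K) ⟶ X) : Spec.map (trivialExtensionFst K PUnit PUnit) ≫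
      Spec.map (trivialExtensionInl _ _ _) ≫ a = a := by
    rw [← Category.assoc, ← Spec.map_comp, trivialExtensionInl_fst, Spec.map_id, Category.id_comp]
  rw [← h' a, this, h']

theorem fromSpecResidueField_base (X : Superscheme.{u}) (x : X)
    (p : Spec (ofCommRing (X.residueField x))) :
    (Hom.toHom (X.fromSpecResidueField x)).base p = x :=
  X.evenScheme.fromSpecResidueField_apply x p

theorem mono_of_injectiveOnTrivialExtensions {X S : Superscheme.{u}} {f : X ⟶ S}
    (hf : LocallyOfFinitePresentation f) (H : InjectiveOnTrivialExtensions f) : Mono f := by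
  refine ⟨fun {T} g h hgh => ?_⟩
  -- The restrictions of `g` and `h` to `Spec κ(t)` coincide by the field case, and the image of its
  -- point is the image of `t`.
  have hb (t : T) : (Hom.toHom g).base t = (Hom.toHom h).base t := by
    have heq : T.fromSpecResidueField t ≫ g = T.fromSpecResidueField t ≫ h :=
      H.eq_of_field (by rw [Category.assoc, hgh, Category.assoc])
    let pt : Spec (ofCommRing (T.residueField t)) := (⊥ : PrimeSpectrum (T.residueField t))
    have := congrArg (fun f => (Hom.toHom f).base pt) heq
    change (Hom.toHom g).base ((Hom.toHom (T.fromSpecResidueField t)).base pt) =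
      (Hom.toHom h).base ((Hom.toHom (T.fromSpecResidueField t)).base pt) at this
    rwa [fromSpecResidueField_base] at this
  refine hom_ext_stalk hb fun t D _ p => ?_
  obtain ⟨A, B, φ, j, i, hj, hi, ⟨q, hq⟩, hφ, hji⟩ := hf ((Hom.toHom h).base t)
  -- As `g` and `h` agree at `t`, one chart `Spec B` serves both, and both push-forwards of `p` lift
  -- to its stalk at `q`.
  obtain ⟨P, hP⟩ := StalkHom.exists_push (Hom.toHom j) hq
    (StalkHom.push (Hom.toHom g) p (hb t))
  obtain ⟨Q, hQ⟩ := StalkHom.exists_push (Hom.toHom j) hq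
    (StalkHom.push (Hom.toHom h) p rfl)
  have hPQ : StalkHom.push (SuperRing.Hom.specMap φ) P rfl =
      StalkHom.push (SuperRing.Hom.specMap φ) Q rfl := by
    have hz : (Hom.toHom i).base ((SuperRing.Hom.specMap φ).base q) =
        (Hom.toHom f).base ((Hom.toHom h).base t) := by
      rw [← hq]
      exact congrArg (fun f => (Hom.toHom f).base q) hji.symm
    have key (P : StalkHom B.specPresheafedSpace q D) :
        StalkHom.push (Hom.toHom i) (StalkHom.push (SuperRing.Hom.specMap φ) P rfl) hz =
          StalkHom.push (Hom.toHom f) (StalkHom.push (Hom.toHom j) P hq) rfl :=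
      (StalkHom.push_comp (SuperRing.Hom.specMap φ) (Hom.toHom i) P rfl hz hz).symm.trans
        ((StalkHom.push_congr (congrArg Hom.toHom hji.symm) P _ (congrArg (Hom.toHom f).base hq)).trans
          (StalkHom.push_comp (Hom.toHom j) (Hom.toHom f) P hq rfl (congrArg (Hom.toHom f).base hq)))
    refine StalkHom.push_injective (Hom.toHom i) hz ?_
    refine (key P).trans (Eq.trans ?_ (key Q).symm)
    rw [hP, hQ]
    exact (StalkHom.push_comp (Hom.toHom g) (Hom.toHom f) p (hb t) rfl
      (congrArg (Hom.toHom f).base (hb t))).symm.trans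
      ((StalkHom.push_congr (congrArg Hom.toHom hgh) p _ rfl).trans
        (StalkHom.push_comp (Hom.toHom h) (Hom.toHom f) p rfl rfl rfl))
  rw [← hP, ← hQ]
  congr 1
  refine StalkHom.ext_spec (hom_eq_of_isLocalRing hφ.finiteType ?_ _ _ ?_)
  · intro K V W _ _ _ _ _ χ χ' ρ h₁ h₂
    have key (χ : B ⟶ trivialExtension K V W) (h : φ ≫ χ = ρ ≫ trivialExtensionInl K V W) :
        (Spec.map χ ≫ j) ≫ f = Spec.map (trivialExtensionInl K V W) ≫ Spec.map ρ ≫ i := by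
      rw [Category.assoc, hji, ← Category.assoc, ← Spec.map_comp, h, Spec.map_comp, Category.assoc]
    have := H K V W _ _ _ (key χ h₁) (key χ' h₂)
    refine Spec.map_injective (Hom.ext' ?_)
    -- The open immersion `j` is a monomorphism of presheafed spaces.
    exact (cancel_mono (Hom.toHom j)).mp (congrArg Hom.toHom this)
  · have := congrArg (fun P => A.toSections ⊤ ≫ P.app ⊤ trivial) hPQ
    exact (toSections_push φ P rfl).symm.trans (this.trans (toSections_push φ Q rfl))

end Superscheme

namespace AlgebraicGeometry.Scheme

/-! ### Residue field extensions -/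

/-- The hypothesis makes `κ(f x) → κ(x)` an epimorphism of rings, so `a ⊗ 1 = 1 ⊗ a` for all `a`.
Faithful flatness over a field then descends `a` to `κ(f x)`. -/
theorem bijective_residueFieldMap {X S : Scheme.{u}} (f : X ⟶ S) (x : X)
    (H : ∀ (R : CommRingCat.{u}) (a b : X.residueField x ⟶ R),
      (Spec.map a ≫ X.fromSpecResidueField x) ≫ f = (Spec.map b ≫ X.fromSpecResidueField x) ≫ f →
        Spec.map a ≫ X.fromSpecResidueField x = Spec.map b ≫ X.fromSpecResidueField x) :
    Function.Bijective (f.residueFieldMap x).hom := by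
  refine ⟨RingHom.injective _, ?_⟩
  have hepi : Epi (f.residueFieldMap x) := ⟨fun {R} a b h =>
    Spec.map_injective ((cancel_mono (X.fromSpecResidueField x)).mp (H R a b (by
    simp only [Category.assoc, ← f.SpecMap_residueFieldMap_fromSpecResidueField]
    rw [← Spec.map_comp_assoc, ← Spec.map_comp_assoc, h])))⟩
  let := (f.residueFieldMap x).hom.toAlgebra
  have hepi' : Epi (CommRingCat.ofHom (algebraMap (S.residueField (f x)) (X.residueField x))) :=
    hepi
  rw [CommRingCat.epi_iff_epi, Algebra.isEpi_iff_forall_one_tmul_eq] at hepi'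
  intro a
  refine (Algebra.IsEffective.of_faithfullyFlat (S.residueField (f x)) (X.residueField x) a).mp ?_
  rw [Algebra.TensorProduct.includeLeftSubRight_apply, sub_eq_zero]
  exact (hepi' a).symm

theorem exists_specMap_comp_eq_fromSpecResidueField {X S : Scheme.{u}} (f : X ⟶ S) (x : X)
    (h : Function.Bijective (f.residueFieldMap x).hom) :
    ∃ ρ : X.residueField x ⟶ S.residueField (f x),
      (Spec.map ρ ≫ X.fromSpecResidueField x) ≫ f = S.fromSpecResidueField (f x) := by
  have : IsIso (f.residueFieldMap x) := (ConcreteCategory.isIso_iff_bijective _).mpr h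
  refine ⟨inv (f.residueFieldMap x), ?_⟩
  rw [Category.assoc, ← f.SpecMap_residueFieldMap_fromSpecResidueField, ← Spec.map_comp_assoc,
    IsIso.hom_inv_id, Spec.map_id, Category.id_comp]

/-- A morphism with a retraction is an immersion, so `d` induces an isomorphism of residue fields at
`x`. Thus `Spec κ(d x)` maps to `Z` through `d`, where `p` and `q` agree, and `c` factors through
`Spec κ(d x)`. -/
theorem specMap_field_comp_eq {X Z : Scheme.{u}} {d : X ⟶ Z} {p q : Z ⟶ X} (hp : d ≫ p = 𝟙 X)
    (hq : d ≫ q = 𝟙 X) {K : Type u} [Field K] (c : Spec (CommRingCat.of K) ⟶ Z) (x : X)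
    (hx : d x = c (IsLocalRing.closedPoint K)) : c ≫ p = c ≫ q := by
  have : IsImmersion (d ≫ p) := hp ▸ inferInstance
  have : IsImmersion d := IsImmersion.of_comp d p
  have hres : Function.Bijective (d.residueFieldMap x).hom := by
    refine ⟨RingHom.injective _, fun a => ?_⟩
    obtain ⟨a, rfl⟩ := X.residue_surjective x a
    obtain ⟨b, rfl⟩ := d.stalkMap_surjective x a
    exact ⟨Z.residue _ b, congrArg (fun f => f.hom b) (residue_residueFieldMap d x)⟩
  obtain ⟨ρ, hρ⟩ := exists_specMap_comp_eq_fromSpecResidueField d x hres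
  have key (z) (hz : d x = z) : Z.fromSpecResidueField z ≫ p = Z.fromSpecResidueField z ≫ q := by
    subst hz
    rw [← hρ, Category.assoc, hp, Category.assoc (_ ≫ _), hq]
  rw [← descResidueField_stalkClosedPointTo_fromSpecResidueField K Z c, Category.assoc,
    Category.assoc, key _ hx]

end AlgebraicGeometry.Scheme

namespace Superscheme

open SuperRing Limits

/-! ### The even scheme and the points with values in commutative rings -/

/-- The morphism of the even schemes induced by a morphism of superschemes. -/
noncomputable def Hom.evenMap {X Y : Superscheme.{u}} (f : X ⟶ Y) : X.evenScheme ⟶ Y.evenScheme :=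
  AlgebraicGeometry.Scheme.Hom.mk (Hom.evenHom f)

/-- The point of the even scheme defined by a point with values in a commutative ring. -/
noncomputable def Hom.evenPoint {R : Type u} [CommRing R] {X : Superscheme.{u}}
    (g : Spec (ofCommRing R) ⟶ X) : AlgebraicGeometry.Spec (CommRingCat.of R) ⟶ X.evenScheme :=
  AlgebraicGeometry.Scheme.Hom.mk (Hom.evenHom g)

/-- A homomorphism of commutative rings as a homomorphism of purely even superrings. -/
def _root_.SuperRing.ofCommRingMap {R R' : Type u} [CommRing R] [CommRing R'] (ρ : R →+* R') :
    ofCommRing R ⟶ ofCommRing R' where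
  even := ρ
  odd := 0
  map_smul _ _ := rfl
  map_mul _ _ := map_zero ρ

theorem Hom.evenPoint_injective {R : Type u} [CommRing R] {X : Superscheme.{u}}
    {g h : Spec (ofCommRing R) ⟶ X} (H : Hom.evenPoint g = Hom.evenPoint h) : g = h := by
  have H' : evenFunctor.mapPresheaf.map (Hom.toHom g) = evenFunctor.mapPresheaf.map (Hom.toHom h) :=
    congrArg (fun f => (AlgebraicGeometry.Scheme.Hom.toLRSHom f).toHom) H
  obtain ⟨⟨b, c⟩, _⟩ := g
  obtain ⟨⟨b', c'⟩, _⟩ := h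
  obtain rfl : b = b' := congrArg PresheafedSpace.Hom.base H'
  refine Hom.ext' (congrArg (PresheafedSpace.Hom.mk b) (NatTrans.ext (funext fun U => ?_)))
  have hc : Functor.whiskerRight c evenFunctor = Functor.whiskerRight c' evenFunctor :=
    eq_of_heq (PresheafedSpace.Hom.mk.inj H').2
  refine SuperRing.hom_ext (fun s => ?_) (fun s => Subtype.ext (funext fun p => ?_))
  · exact congrArg (fun f => (f.app U).hom s) hc
  -- The odd sections take values in localizations of the zero module, so the odd component of a
  -- morphism is forced.
  · let q : PrimeSpectrum R := p.1
    exact Subsingleton.elim (α := LocalizedModule q.asIdeal.primeCompl PUnit.{u + 1}) _ _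

/-! ### Residue fields of monomorphisms -/

/-- Points through `Spec κ(x)` with values in a commutative ring lift to morphisms from purely even
spectra, to which cancellation of `f` applies. -/
theorem bijective_residueFieldMap {X S : Superscheme.{u}} (f : X ⟶ S) [Mono f] (x : X) :
    Function.Bijective ((Hom.evenMap f).residueFieldMap x).hom := by
  refine Scheme.bijective_residueFieldMap (Hom.evenMap f) x fun R a b h => ?_
  let ι (a : X.evenScheme.residueField x ⟶ R) : Spec (ofCommRing R) ⟶ X :=
    Spec.map (ofCommRingMap (R := X.residueField x) a.hom) ≫ X.fromSpecResidueField x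
  have h' : ι a = ι b := (cancel_mono f).mp (Hom.evenPoint_injective h)
  exact congrArg Hom.evenPoint h'

/-! ### Empty superschemes -/

theorem subsingleton_even (T : Superscheme.{u}) [IsEmpty T] (W : Opens T) :
    Subsingleton (T.toPresheafedSpace.presheaf.obj (op W)).even :=
  ⟨fun _ _ => even_ext fun x => isEmptyElim x⟩

theorem subsingleton_odd (T : Superscheme.{u}) [IsEmpty T] (W : Opens T) :
    Subsingleton (T.toPresheafedSpace.presheaf.obj (op W)).odd :=
  ⟨fun _ _ => odd_ext fun x => isEmptyElim x⟩

theorem hom_eq_of_isEmpty {T X : Superscheme.{u}} [IsEmpty T] (g h : T ⟶ X) : g = h :=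
  hom_ext_stalk (fun x => isEmptyElim x) (fun x => isEmptyElim x)

theorem nonempty_hom_of_isEmpty (T X : Superscheme.{u}) [IsEmpty T] : Nonempty (T ⟶ X) := by
  let b : T.toPresheafedSpace.carrier ⟶ X.toPresheafedSpace.carrier :=
    TopCat.ofHom ⟨fun x => isEmptyElim x, continuous_of_const fun x => isEmptyElim x⟩
  have h₀ := T.subsingleton_even
  have h₁ := T.subsingleton_odd
  refine ⟨⟨⟨b, ⟨fun U => ⟨⟨⟨⟨fun _ => 0, (h₀ _).elim _ _⟩, fun _ _ => (h₀ _).elim _ _⟩,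
    (h₀ _).elim _ _, fun _ _ => (h₀ _).elim _ _⟩, ⟨⟨fun _ => 0, (h₁ _).elim _ _⟩,
    fun _ _ => (h₁ _).elim _ _⟩, fun _ _ => (h₁ _).elim _ _, fun _ _ => (h₀ _).elim _ _⟩,
    fun U V i => ?_⟩⟩, fun x => isEmptyElim x⟩⟩
  exact SuperRing.hom_ext (fun _ => (h₀ _).elim _ _) (fun _ => (h₁ _).elim _ _)

instance : IsEmpty (Spec (ofCommRing PUnit.{u + 1})) :=
  inferInstanceAs (IsEmpty (PrimeSpectrum PUnit.{u + 1}))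

/-! ### The implications -/

/-- For a monomorphism the fibre product exists, and the first projection is inverse to the
diagonal, so it supplies the preimages. -/
theorem radicial_of_mono {X S : Superscheme.{u}} (f : X ⟶ S) [Mono f] : Radicial f := by
  refine ⟨inferInstance, fun z => ⟨(Hom.toHom (pullback.fst f f)).base z, ?_⟩⟩
  have h : pullback.fst f f ≫ pullback.diagonal f = 𝟙 _ := by
    rw [← cancel_mono (pullback.fst f f), Category.assoc, pullback.diagonal_fst, Category.comp_id,
      Category.id_comp]
  exact congrArg (fun g => (Hom.toHom g).base z) h

theorem formallyUnramified_of_mono {X S : Superscheme.{u}} (f : X ⟶ S) [Mono f] :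
    FormallyUnramified f := fun _ _ _ _ _ _ _ _ hg hh _ => (cancel_mono f).mp (hg.trans hh.symm)

/-- Inverting the residue field map lifts `Spec κ(f x)` to `X`. As `f` is a monomorphism, a cone is
then determined by its leg to `Spec κ(f x)`. -/
theorem isPullback_fromSpecResidueField {X S : Superscheme.{u}} (f : X ⟶ S) [Mono f] (x : X) :
    ∃ g, IsPullback (𝟙 _) g (S.fromSpecResidueField ((Hom.toHom f).base x)) f := by
  obtain ⟨ρ, hρ⟩ := Scheme.exists_specMap_comp_eq_fromSpecResidueField (Hom.evenMap f) x
    (bijective_residueFieldMap f x)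
  let g : Spec (ofCommRing (S.residueField ((Hom.toHom f).base x))) ⟶ X :=
    Spec.map (ofCommRingMap (R := X.residueField x) ρ.hom) ≫ X.fromSpecResidueField x
  have hg : g ≫ f = S.fromSpecResidueField _ := Hom.evenPoint_injective hρ
  refine ⟨g, ⟨⟨by rw [Category.id_comp, hg]⟩, ⟨PullbackCone.IsLimit.mk _ (fun s => s.fst)
    (fun s => Category.comp_id _) (fun s => ?_) (fun s m hm _ => ?_)⟩⟩⟩
  · rw [← cancel_mono f, Category.assoc, hg, s.condition]
  · rw [← hm, Category.comp_id]

/-- A point of a cone would give points of `X` and `Z` with the same image, so every cone is empty;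
the spectrum of the zero ring is therefore universal. -/
theorem isPullback_empty {X S Z : Superscheme.{u}} (f : X ⟶ S) (c : Z ⟶ S)
    (h : ∀ x z, (Hom.toHom f).base x ≠ (Hom.toHom c).base z) :
    ∃ (p : Spec (ofCommRing PUnit.{u + 1}) ⟶ Z) (q : _ ⟶ X), IsPullback p q c f := by
  obtain ⟨p⟩ := nonempty_hom_of_isEmpty (Spec (ofCommRing PUnit.{u + 1})) Z
  obtain ⟨q⟩ := nonempty_hom_of_isEmpty (Spec (ofCommRing PUnit.{u + 1})) X
  have hs (s : PullbackCone c f) : IsEmpty s.pt := ⟨fun t => h ((Hom.toHom s.snd).base t)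
    ((Hom.toHom s.fst).base t) (congrArg (fun g => (Hom.toHom g).base t) s.condition.symm)⟩
  exact ⟨p, q, ⟨⟨hom_eq_of_isEmpty _ _⟩, ⟨PullbackCone.IsLimit.mk _
    (fun s => have := hs s; (nonempty_hom_of_isEmpty s.pt _).some)
    (fun s => have := hs s; hom_eq_of_isEmpty _ _) (fun s => have := hs s; hom_eq_of_isEmpty _ _)
    (fun s _ _ _ => have := hs s; hom_eq_of_isEmpty _ _)⟩⟩⟩

theorem fiberEmptyOrPoint_of_mono {X S : Superscheme.{u}} (f : X ⟶ S) [Mono f] (s : S) :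
    FiberEmptyOrPoint f s := by
  by_cases hs : ∃ x, (Hom.toHom f).base x = s
  · obtain ⟨x, rfl⟩ := hs
    obtain ⟨g, hg⟩ := isPullback_fromSpecResidueField f x
    have := hg.hasPullback
    exact ⟨this, .inr ⟨(Over.isoMk hg.isoPullback (hg.isoPullback_hom_fst)).symm⟩⟩
  · obtain ⟨p, q, h⟩ := isPullback_empty f (S.fromSpecResidueField s) fun x z hx =>
      hs ⟨x, hx.trans (fromSpecResidueField_base S s z)⟩
    have := h.hasPullback
    exact ⟨this, .inl ⟨fun z => isEmptyElim ((Hom.toHom h.isoPullback.inv).base z)⟩⟩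

/-- The even scheme of `X ×_S X` need not be a fibre product of even schemes. It is enough that the
diagonal is a common section of both projections and hits the point of `(a, b)`. -/
theorem Radicial.eq_of_field {X S : Superscheme.{u}} {f : X ⟶ S} (hf : Radicial f) {K : Type u}
    [Field K] {a b : Spec (ofCommRing K) ⟶ X} (h : a ≫ f = b ≫ f) : a = b := by
  obtain ⟨_, hΔ⟩ := hf
  let u := pullback.lift a b h
  obtain ⟨x, hx⟩ := hΔ (Hom.evenPoint u (IsLocalRing.closedPoint K))
  have hu : Hom.evenPoint u ≫ Hom.evenMap (pullback.fst f f) =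
      Hom.evenPoint u ≫ Hom.evenMap (pullback.snd f f) :=
    Scheme.specMap_field_comp_eq (d := Hom.evenMap (pullback.diagonal f)) (congrArg Hom.evenMap (pullback.diagonal_fst f))
      (congrArg Hom.evenMap (pullback.diagonal_snd f)) (Hom.evenPoint u) x hx
  have hu' : u ≫ pullback.fst f f = u ≫ pullback.snd f f := Hom.evenPoint_injective hu
  exact (pullback.lift_fst a b h).symm.trans (hu'.trans (pullback.lift_snd a b h))

/-- `Spec K` is cut out in the spectrum of the trivial extension by an ideal of square zero:
radiciality gives equality on `Spec K`, and formal unramifiedness extends it. -/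
theorem injectiveOnTrivialExtensions_of_radicial {X S : Superscheme.{u}} {f : X ⟶ S}
    (hf : Radicial f) (hf' : FormallyUnramified f) : InjectiveOnTrivialExtensions f := by
  intro K V W _ _ _ _ _ a b c ha hb
  refine hf' _ _ (trivialExtensionFst K V W) (trivialExtensionFst_surjective K V W)
    (isNilpotent_ker_trivialExtensionFst K V W) _ a b ha hb (hf.eq_of_field ?_)
  rw [Category.assoc, ha, Category.assoc, hb]

theorem exists_factor_residueField {S : Superscheme.{u}} {K : Type u} [Field K]
    (c : Spec (ofCommRing K) ⟶ S) :
    ∃ (s : S) (d : Spec (ofCommRing K) ⟶ Spec (ofCommRing (S.residueField s))),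
      c = d ≫ S.fromSpecResidueField s := by
  let e := Hom.evenPoint c
  let s : S := e (IsLocalRing.closedPoint K)
  let ρ : S.evenScheme.residueField (e (IsLocalRing.closedPoint K)) ⟶ CommRingCat.of K :=
    Scheme.descResidueField (Scheme.stalkClosedPointTo e)
  have h : AlgebraicGeometry.Spec.map ρ ≫ S.evenScheme.fromSpecResidueField
      (e (IsLocalRing.closedPoint K)) = e :=
    Scheme.descResidueField_stalkClosedPointTo_fromSpecResidueField K _ e
  exact ⟨s, Spec.map (ofCommRingMap (R := S.residueField s) ρ.hom),
    Hom.evenPoint_injective h.symm⟩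

/-- Both morphisms factor through the fibre over a point `s`. It cannot be empty, as the test object
has a point, so its projection to `Spec κ(s)` is an isomorphism and can be cancelled. -/
theorem injectiveOnTrivialExtensions_of_fiber {X S : Superscheme.{u}} {f : X ⟶ S}
    (hf : ∀ s, FiberEmptyOrPoint f s) : InjectiveOnTrivialExtensions f := by
  intro K V W _ _ _ _ _ a b c ha hb
  obtain ⟨s, d, rfl⟩ := exists_factor_residueField c
  obtain ⟨_, h⟩ := hf s
  rw [← Category.assoc] at ha hb
  let a' := pullback.lift _ a ha.symm
  let b' := pullback.lift _ b hb.symm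
  obtain h | ⟨⟨e⟩⟩ := h
  · let pt : Spec (ofCommRing K) := (⊥ : PrimeSpectrum K)
    exact isEmptyElim ((Hom.toHom a').base
      ((Hom.toHom (Spec.map (trivialExtensionFst K V W))).base pt))
  -- An isomorphism over `κ(s)` onto `Spec κ(s)` itself must be the structure morphism.
  · have he : e.hom.left = pullback.fst (S.fromSpecResidueField s) f :=
      (Category.comp_id _).symm.trans (Over.w e.hom)
    have : IsIso (pullback.fst (S.fromSpecResidueField s) f) := by
      rw [← he]
      exact inferInstanceAs (IsIso ((Over.forget _).map e.hom))
    have hab : a' = b' := by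
      rw [← cancel_mono (pullback.fst (S.fromSpecResidueField s) f), pullback.lift_fst,
        pullback.lift_fst]
    exact (pullback.lift_snd _ a ha.symm).symm.trans
      ((congrArg (· ≫ pullback.snd _ _) hab).trans (pullback.lift_snd _ b hb.symm))

end Superscheme

theorem mainTheorem9 {X S : Superscheme.{u}} (f : X ⟶ S)
    (hf : Superscheme.LocallyOfFinitePresentation f) :
    List.TFAE [Mono f,
      Superscheme.Radicial f ∧ Superscheme.FormallyUnramified f,
      ∀ s : S, Superscheme.FiberEmptyOrPoint f s] := by
  tfae_have 1 → 2 := fun _ =>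
    ⟨Superscheme.radicial_of_mono f, Superscheme.formallyUnramified_of_mono f⟩
  tfae_have 2 → 1 := fun h => Superscheme.mono_of_injectiveOnTrivialExtensions hf
    (Superscheme.injectiveOnTrivialExtensions_of_radicial h.1 h.2)
  tfae_have 1 → 3 := fun _ => Superscheme.fiberEmptyOrPoint_of_mono f
  tfae_have 3 → 1 := fun h => Superscheme.mono_of_injectiveOnTrivialExtensions hf
    (Superscheme.injectiveOnTrivialExtensions_of_fiber h)
  tfae_finish
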